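/- **Setting.** Let $(W,S)$ be a Coxeter system with $S$ finite, $\Bbbk$ an integral domain, and $\mathfrak h=(V,\{\alpha_s^\vee\}_{s\in S},\{\alpha_s\}_{s\in S})$ a realization of $(W,S)$ over $\Bbbk$: $V$ is a free $\Bbbk$-module of finite rank, $\alpha_s^\vee\in V$, $\alpha_s\in V^*$, $\langle\alpha_s^\vee,\alpha_s\rangle=2$, the assignment $s\mapsto(v\mapsto v-\langle\alpha_s,v\rangle\alpha_s^\vee)$ defines a representation of $W$ on $V$, and the two-colored quantum numbers satisfy $[m_{st}]_s=[m_{st}]_t=0$ whenever $s\ne t$ and $m_{st}<\infty$. Assume that $\mathfrak h$ is balanced ($[m_{st}-1]_s=[m_{st}-1]_t=1$ for such $s,t$) and satisfies Demazure surjectivity ($\alpha_s:V\to\Bbbk$ and $\alpha_s^\vee:V^*\to\Bbbk$ are surjective for all $s$). Let $\mathscr D_{\mathrm{BS}}(\mathfrak h,W)$ be the Elias–Williamson diagrammatic category, with objects $B_{\underline w}$ for words $\underline w$ in $S$ and graded morphism modules, and let $\mathscr D^\oplus_{\mathrm{BS}}$ be its additive hull: objects are finite direct sums of $B_{\underline w}(n)$,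 $n\in\mathbb Z$, and $\mathrm{Hom}(B_{\underline w}(n),B_{\underline v}(m))$ is the part of degree $m-n$ of the morphisms $B_{\underline w}\to B_{\underline v}$. A *sequence* is a family $\mathcal F=(\mathcal F^i)_{i\in\mathbb Z}$ of objects of $\mathscr D^\oplus_{\mathrm{BS}}$ almost all of which are zero. For sequences $\mathcal F,\mathcal G$ let $\underline{\mathrm{Hom}}_{\mathsf{BE}}(\mathcal F,\mathcal G)$ be the bigraded $\Bbbk$-module with $$\underline{\mathrm{Hom}}_{\mathsf{BE}}(\mathcal F,\mathcal G)^i_j=\prod_{q-p=i-j}\mathrm{Hom}(\mathcal F^p,\mathcal G^q(j)),$$ with the evident composition $g\circ f=g(j)\bullet f$ for $f:\mathcal F^p\to\mathcal G^q(j)$; an element $r\in V^*$ acts on it with bidegree $(2,2)$ by $f\mapsto r\star f$, i.e. by placing a box labelled $r$ to the left. Let $\Lambda$ be the exterior algebra of $V^*$, with $V^*$ in bidegree $(1,2)$, and put $\underline{\mathrm{Hom}}_{\mathsf{LM}}(\mathcal F,\mathcal G)=\Lambda\otimes_\Bbbk\underline{\mathrm{Hom}}_{\mathsf{BE}}(\mathcal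 F,\mathcal G)$, with composition $(r\otimes f)\circ(s\otimes g)=(-1)^{|f||s|}(r\wedge s)\otimes(f\circ g)$, where $|\cdot|$ is the first (cohomological) degree. Let $$\kappa((r_1\wedge\cdots\wedge r_n)\otimes f)=\sum_{i}(-1)^{i+1}(r_1\wedge\cdots\widehat{r_i}\cdots\wedge r_n)\otimes(r_i\star f),$$ and, for $x\in V$, let $$x\frown((r_1\wedge\cdots\wedge r_n)\otimes f)=\sum_i(-1)^{i+1}r_i(x)\,(r_1\wedge\cdots\widehat{r_i}\cdots\wedge r_n)\otimes f .$$ A *left-monodromic complex* is a pair $(\mathcal F,\delta_{\mathcal F})$ of a sequence $\mathcal F$ and an element $\delta_{\mathcal F}\in\underline{\mathrm{Hom}}_{\mathsf{LM}}(\mathcal F,\mathcal F)^1_0$ with $\delta_{\mathcal F}\circ\delta_{\mathcal F}+\kappa(\delta_{\mathcal F})=0$. For two of them, $\underline{\mathrm{Hom}}_{\mathsf{LM}}(\mathcal F,\mathcal G)$ carries the differential $d(f)=\kappa(f)+\delta_{\mathcal G}\circ f+(-1)^{|f|+1}f\circ\delta_{\mathcal F}$; let $\mathrm{gHom}_{\mathsf{LM}}(\mathcal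 F,\mathcal G)$ be its bigraded cohomology, with the induced composition, and $\mathrm{gEnd}_{\mathsf{LM}}(\mathcal F)=\mathrm{gHom}_{\mathsf{LM}}(\mathcal F,\mathcal F)$. Let $R^\vee=\mathrm{Sym}(V)$, with $V$ in bidegree $(0,-2)$. **Theorem.** (1) For every left-monodromic complex $\mathcal F$ and every $x\in V$, $x\frown\delta_{\mathcal F}$ is a cocycle, and there is a unique $\Bbbk$-algebra homomorphism $\mu_{\mathcal F}:R^\vee\to\mathrm{gEnd}_{\mathsf{LM}}(\mathcal F)$ such that $\mu_{\mathcal F}(x)$ is the class of $x\frown\delta_{\mathcal F}$ for all $x\in V$. It is bigraded: it maps $\mathrm{Sym}^n(V)$ to bidegree $(0,-2n)$. (2) For all left-monodromic complexes $\mathcal F,\mathcal G$, the formula $$y\mathbin{\widehat\star}f=\mu_{\mathcal G}(y)\circ f=f\circ\mu_{\mathcal F}(y)\qquad(y\in R^\vee,\ f\in\mathrm{gHom}_{\mathsf{LM}}(\mathcal F,\mathcal G))$$ holds (the two right-hand sides agree) and makes $\mathrm{gHom}_{\mathsf{LM}}(\mathcal F,\mathcal G)$ a bigraded left $R^\vee$-module.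 (3) For all $f\in\mathrm{gHom}_{\mathsf{LM}}(\mathcal F,\mathcal G)$, $g\in\mathrm{gHom}_{\mathsf{LM}}(\mathcal G,\mathcal H)$ and $y\in R^\vee$, $$y\mathbin{\widehat\star}(g\circ f)=(y\mathbin{\widehat\star}g)\circ f=g\circ(y\mathbin{\widehat\star}f).$$ -/

import Mathlib

open scoped TensorProduct DirectSum


noncomputable section

namespace LeftMonodromy

/-! ## Realizations of Coxeter systems -/

/-- The part of polynomial degree `n` of a symmetric algebra. -/
def symDeg (k N : Type*) [CommRing k] [AddCommGroup N] [Module k N] (n : ℕ) :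
    Submodule k (SymmetricAlgebra k N) :=
  LinearMap.range (SymmetricAlgebra.ι k N) ^ n

/-- The `2`-colored quantum number `[n]_x` evaluated at `x, y`
(the number `[n]_y` is `qnum y x n`). -/
def qnum {k : Type*} [CommRing k] (x y : k) : ℕ → k
  | 0 => 0
  | 1 => 1
  | n + 2 => (if Even n then x else y) * qnum x y (n + 1) - qnum x y n

/-- A balanced realization, satisfying Demazure surjectivity, of the Coxeter system `cs`.
Conditions indexed by an ordered pair `(s, t)` are imposed for `(t, s)` as well, so that
`quantum_zero` and `balanced` contain the conditions on both `[n]_s` and `[n]_t`.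
The entry `M s t = 0` means that `st` has infinite order. -/
structure Realization {B W : Type*} [Group W] {M : CoxeterMatrix B} (cs : CoxeterSystem M W)
    (k V : Type*) [CommRing k] [AddCommGroup V] [Module k V] where
  coroot : B → V
  root : B → Module.Dual k V
  root_coroot : ∀ s, root s (coroot s) = 2
  exists_rep : ∃ ρ : Representation k W V,
    ∀ s v, ρ (cs.simple s) v = v - root s v • coroot s
  quantum_zero : ∀ s t, s ≠ t → M s t ≠ 0 →
    qnum (-root t (coroot s)) (-root s (coroot t)) (M s t) = 0
  balanced : ∀ s t, s ≠ t → M s t ≠ 0 →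
    qnum (-root t (coroot s)) (-root s (coroot t)) (M s t - 1) = 1
  root_surjective : ∀ s, Function.Surjective (root s)
  coroot_surjective : ∀ s, Function.Surjective (fun r : Module.Dual k V => r (coroot s))

variable {B W : Type*} [Group W] {M : CoxeterMatrix B} {cs : CoxeterSystem M W}
variable {k V : Type*} [CommRing k] [AddCommGroup V] [Module k V]

namespace Realization

/-- The action of the simple reflection `s` on `V^*`. -/
def reflDual (𝔥 : Realization cs k V) (s : B) : Module.Dual k V →ₗ[k] Module.Dual k V :=
  LinearMap.id - (Module.Dual.eval k V (𝔥.coroot s)).smulRight (𝔥.root s)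

/-- The action of the simple reflection `s` on `S(V^*)`. -/
def reflSym (𝔥 : Realization cs k V) (s : B) :
    SymmetricAlgebra k (Module.Dual k V) →ₐ[k] SymmetricAlgebra k (Module.Dual k V) :=
  SymmetricAlgebra.lift (SymmetricAlgebra.ι k (Module.Dual k V) ∘ₗ 𝔥.reflDual s)

/-- The simple root `α_s` as an element of `S(V^*)`. -/
def rootSym (𝔥 : Realization cs k V) (s : B) : SymmetricAlgebra k (Module.Dual k V) :=
  SymmetricAlgebra.ι k (Module.Dual k V) (𝔥.root s)

theorem reflDual_reflDual (𝔥 : Realization cs k V) (s : B) (r : Module.Dual k V) :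
    𝔥.reflDual s (𝔥.reflDual s r) = r := by
  simp only [reflDual, LinearMap.sub_apply, LinearMap.id_apply, LinearMap.smulRight_apply,
    Module.Dual.eval_apply, LinearMap.smul_apply, 𝔥.root_coroot, smul_eq_mul]
  module

theorem reflSym_injective (𝔥 : Realization cs k V) (s : B) :
    Function.Injective (𝔥.reflSym s).toRingHom := by
  have h : (𝔥.reflSym s).comp (𝔥.reflSym s) = AlgHom.id k _ := by
    apply SymmetricAlgebra.algHom_ext
    ext r
    simp [reflSym, reflDual_reflDual]
  exact Function.LeftInverse.injective (g := 𝔥.reflSym s) fun x => DFunLike.congr_fun h x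

end Realization

/-! ## Diagrams -/

/-- The alternating word `(s, t, s, …)` of length `n`. -/
def alt (s t : B) : ℕ → List B
  | 0 => []
  | n + 1 => s :: alt t s n

/-- The letter of index `n` (counted from `0`) of the infinite word `(s, t, s, …)`. -/
def altLetter (s t : B) : ℕ → B
  | 0 => s
  | n + 1 => altLetter t s n

theorem alt_append (s t : B) (n : ℕ) : alt s t n ++ [altLetter s t n] = alt s t (n + 1) := by
  induction n generalizing s t with
  | zero => rfl
  | succ n ih => simp only [alt, altLetter, List.cons_append, ih]

theorem alt_append_append (s t : B) (n : ℕ) (l : List B) :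
    alt s t n ++ (altLetter s t n :: l) = alt s t (n + 1) ++ l := by
  rw [← alt_append, List.append_assoc, List.singleton_append]

/-- Formal `k`-linear combinations of Elias–Williamson diagrams, before imposing any relation:
`Diag 𝔥 w v d` consists of the formal expressions of degree `d` from `B_w` (bottom) to `B_v`
(top).  The equations between words and degrees which appear as arguments of `comp` and `tensor`
make casts unnecessary. -/
inductive Diag (𝔥 : Realization cs k V) : List B → List B → ℤ → Type _
  | id (w : List B) : Diag 𝔥 w w 0
  | box (n : ℕ) (f : SymmetricAlgebra k (Module.Dual k V))
      (hf : f ∈ symDeg k (Module.Dual k V) n) {d : ℤ} (hd : d = 2 * n) : Diag 𝔥 [] [] d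
  | endDot (s : B) : Diag 𝔥 [s] [] 1
  | startDot (s : B) : Diag 𝔥 [] [s] 1
  | split (s : B) : Diag 𝔥 [s] [s, s] (-1)
  | merge (s : B) : Diag 𝔥 [s, s] [s] (-1)
  | vertex (s t : B) (hst : s ≠ t) {m : ℕ} (hm : M s t = m) (hm0 : m ≠ 0) :
      Diag 𝔥 (alt s t m) (alt t s m) 0
  | comp {w v u : List B} {d e n : ℤ} (g : Diag 𝔥 v u e) (f : Diag 𝔥 w v d) (hn : e + d = n) :
      Diag 𝔥 w u n
  | tensor {w v w' v' x y : List B} {d d' n : ℤ} (f : Diag 𝔥 w v d) (f' : Diag 𝔥 w' v' d')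
      (hx : w ++ w' = x) (hy : v ++ v' = y) (hn : d + d' = n) : Diag 𝔥 x y n
  | zero (w v : List B) (d : ℤ) : Diag 𝔥 w v d
  | add {w v : List B} {d : ℤ} (f g : Diag 𝔥 w v d) : Diag 𝔥 w v d
  | smul {w v : List B} {d : ℤ} (c : k) (f : Diag 𝔥 w v d) : Diag 𝔥 w v d

namespace Diag

variable {𝔥 : Realization cs k V}

/-- The cap `B_{(s,s)} → B_∅`. -/
def cap (𝔥 : Realization cs k V) (s : B) : Diag 𝔥 [s, s] [] 0 :=
  comp (endDot s) (merge s) (by norm_num)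

/-- The cup `B_∅ → B_{(s,s)}`. -/
def cup (𝔥 : Realization cs k V) (s : B) : Diag 𝔥 [] [s, s] 0 :=
  comp (split s) (startDot s) (by norm_num)

end Diag

/-! ## Jones–Wenzl projectors

`JW_w`, for the alternating word `w = (s, t, …)` of length `m`, is the image in `End(B_w)` of the
Jones–Wenzl projector of the `2`-colored Temperley–Lieb algebra on `m - 1` strands, i.e. of the
unique element with constant term `1` that is annihilated by all the generators `u_i`. The
generator `u_i` acts on the letters of index `i, i+1, i+2`. -/

/-- Defining relations of the `2`-colored Temperley–Lieb algebra attached to the alternating word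
`(s, t, …)` of length `n + 2`. -/
inductive TLRel (𝔥 : Realization cs k V) (s t : B) (n : ℕ) :
    FreeAlgebra k (Fin n) → FreeAlgebra k (Fin n) → Prop
  | sq (i : Fin n) : TLRel 𝔥 s t n (FreeAlgebra.ι k i * FreeAlgebra.ι k i)
      (𝔥.root (altLetter s t (i + 1)) (𝔥.coroot (altLetter s t i)) • FreeAlgebra.ι k i)
  | braid (i j : Fin n) (h : (i : ℕ) + 1 = j ∨ (j : ℕ) + 1 = i) :
      TLRel 𝔥 s t n (FreeAlgebra.ι k i * FreeAlgebra.ι k j * FreeAlgebra.ι k i) (FreeAlgebra.ι k i)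
  | far (i j : Fin n) (h : (i : ℕ) + 1 < j) :
      TLRel 𝔥 s t n (FreeAlgebra.ι k i * FreeAlgebra.ι k j)
        (FreeAlgebra.ι k j * FreeAlgebra.ι k i)

/-- The element of the free algebra described by a list of coefficients and words. -/
def freeSum (k : Type*) [CommRing k] {n : ℕ} (l : List (k × List (Fin n))) :
    FreeAlgebra k (Fin n) :=
  (l.map fun c => c.1 • (c.2.map (FreeAlgebra.ι k)).prod).sum

/-- `l` represents the Jones–Wenzl projector attached to the alternating word `(s, t, …)` of
length `n + 2`. -/
def IsJonesWenzl (𝔥 : Realization cs k V) (s t : B) (n : ℕ) (l : List (k × List (Fin n))) : Prop :=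
  FreeAlgebra.lift k (fun _ : Fin n => (0 : k)) (freeSum k l) = 1 ∧
  ∀ i : Fin n, RingQuot.mkAlgHom k (TLRel 𝔥 s t n) (FreeAlgebra.ι k i * freeSum k l) = 0

namespace Diag

variable {𝔥 : Realization cs k V}

/-- The image of the Temperley–Lieb generator `u_0` in `End(B_{(s,t,s)})`. -/
def tlCore (𝔥 : Realization cs k V) (s t : B) : Diag 𝔥 [s, t, s] [s, t, s] 0 :=
  comp
    (comp (tensor (tensor (id [s]) (startDot t) rfl rfl rfl) (id [s]) rfl rfl rfl)
      (split s) (n := 0) (by norm_num) : Diag 𝔥 [s] [s, t, s] 0)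
    (comp (merge s)
      (tensor (tensor (id [s]) (endDot t) rfl rfl rfl) (id [s]) rfl rfl rfl)
      (n := 0) (by norm_num) : Diag 𝔥 [s, t, s] [s] 0)
    (by norm_num)

/-- The image of the Temperley–Lieb generator `u_i` in `End(B_{(s,t,…)})`. -/
def tlGen (𝔥 : Realization cs k V) : (s t : B) → (m i : ℕ) → Diag 𝔥 (alt s t m) (alt s t m) 0
  | s, t, m + 3, 0 => tensor (tlCore 𝔥 s t) (id (alt t s m)) rfl rfl (by norm_num)
  | s, t, m + 1, i + 1 => tensor (id [s]) (tlGen 𝔥 t s m i) rfl rfl (by norm_num)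
  | s, t, m, _ => zero (alt s t m) (alt s t m) 0

/-- The image of a product of Temperley–Lieb generators. -/
def tlWord (𝔥 : Realization cs k V) (s t : B) (m : ℕ) {n : ℕ} :
    List (Fin n) → Diag 𝔥 (alt s t m) (alt s t m) 0
  | [] => id (alt s t m)
  | i :: l => comp (tlGen 𝔥 s t m i) (tlWord 𝔥 s t m l) (by norm_num)

/-- The image of a linear combination of products of Temperley–Lieb generators. -/
def tlSum (𝔥 : Realization cs k V) (s t : B) (m : ℕ) {n : ℕ} :
    List (k × List (Fin n)) → Diag 𝔥 (alt s t m) (alt s t m) 0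
  | [] => zero _ _ 0
  | c :: l => add (smul c.1 (tlWord 𝔥 s t m c.2)) (tlSum 𝔥 s t m l)

end Diag

/-! ## Localization and rex moves

Over the fraction field `Q` of `S(V^*)`, the object `B_w` becomes a direct sum of standard objects
indexed by the subexpressions of `w`, and a morphism becomes a matrix with entries in `Q`.
A subexpression is encoded as a list of booleans. -/

section Localization

variable [IsDomain k] [Module.Free k V] [Module.Finite k V]

/-- The fraction field of `S(V^*)`. -/
abbrev FracR (k V : Type*) [CommRing k] [AddCommGroup V] [Module k V] : Type _ :=
  FractionRing (SymmetricAlgebra k (Module.Dual k V))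

/-- The action of the simple reflection `s` on the fraction field of `S(V^*)`. -/
def Realization.reflFrac (𝔥 : Realization cs k V) (s : B) : FracR k V →+* FracR k V :=
  IsFractionRing.map (𝔥.reflSym_injective s)

/-- The action of the element expressed by a word. -/
def Realization.wordFrac (𝔥 : Realization cs k V) : List B → FracR k V →+* FracR k V
  | [] => RingHom.id _
  | s :: w => (𝔥.reflFrac s).comp (Realization.wordFrac 𝔥 w)

/-- The simple root `α_s` in the fraction field. -/
def Realization.rootFrac (𝔥 : Realization cs k V) (s : B) : FracR k V :=
  algebraMap _ _ (𝔥.rootSym s)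

/-- The subword of `w` selected by `e`. -/
def subword (w : List B) (e : List Bool) : List B :=
  ((w.zip e).filter Prod.snd).map Prod.fst

/-- All lists of booleans of length `n`. -/
def allBools : ℕ → List (List Bool)
  | 0 => [[]]
  | n + 1 => (allBools n).map (List.cons false) ++ (allBools n).map (List.cons true)

/-- The product over the positions `i` of the word `(s_1, …, s_r)` of the roots
`s_1 ⋯ s_{i-1} (α_{s_i})`. -/
def Realization.rootProd (𝔥 : Realization cs k V) : List B → FracR k V
  | [] => 1
  | s :: x => 𝔥.rootFrac s * 𝔥.reflFrac s (Realization.rootProd 𝔥 x)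

/-- The product over the positions `i` of the word `(s_1, …, s_r)` of the roots
`s_1^{e_1} ⋯ s_i^{e_i} (α_{s_i})`. -/
def Realization.subRootProd (𝔥 : Realization cs k V) : List B → List Bool → FracR k V
  | s :: x, true :: e => 𝔥.reflFrac s (𝔥.rootFrac s * Realization.subRootProd 𝔥 x e)
  | s :: x, false :: e => 𝔥.rootFrac s * Realization.subRootProd 𝔥 x e
  | _, _ => 1

open Classical in
/-- The matrix of a diagram after localization: `loc f e h` is the entry from the summand of the
source indexed by the subexpression `e` to the summand of the target indexed by `h`. -/
def loc (𝔥 : Realization cs k V) : {w v : List B} → {d : ℤ} → Diag 𝔥 w v d →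
    List Bool → List Bool → FracR k V
  | _, _, _, .id _, e, h => if e = h then 1 else 0
  | _, _, _, .box _ f _ _, _, _ => algebraMap _ _ f
  | _, _, _, .endDot _, e, _ => if e = [false] then 1 else 0
  | _, _, _, .startDot s, _, h => if h = [false] then 𝔥.rootFrac s else 0
  | _, _, _, .split _, e, h =>
      if e = [false] ∧ (h = [false, false] ∨ h = [true, true]) ∨
        e = [true] ∧ (h = [false, true] ∨ h = [true, false]) then 1 else 0
  | _, _, _, .merge s, e, h =>
      if e = [false, false] ∧ h = [false] ∨ e = [false, true] ∧ h = [true] then (𝔥.rootFrac s)⁻¹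
      else if e = [true, true] ∧ h = [false] ∨ e = [true, false] ∧ h = [true] then
        -(𝔥.rootFrac s)⁻¹
      else 0
  | _, _, _, .vertex s t _ (m := m) _ _, e, h =>
      if cs.wordProd (subword (alt s t m) e) = cs.wordProd (subword (alt t s m) h) then
        𝔥.wordFrac (subword (alt s t m) e) (𝔥.rootProd (alt s t m)) /
          𝔥.subRootProd (alt s t m) e
      else 0
  | _, _, _, .comp (v := v) g f _, e, h =>
      ((allBools v.length).map fun c => loc 𝔥 f e c * loc 𝔥 g c h).sum
  | _, _, _, .tensor (w := w) (v := v) f f' _ _ _, e, h =>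
      loc 𝔥 f (e.take w.length) (h.take v.length) *
        𝔥.wordFrac (subword w (e.take w.length))
          (loc 𝔥 f' (e.drop w.length) (h.drop v.length))
  | _, _, _, .zero _ _ _, _, _ => 0
  | _, _, _, .add f g, e, h => loc 𝔥 f e h + loc 𝔥 g e h
  | _, _, _, .smul c f, e, h => algebraMap k _ c * loc 𝔥 f e h

end Localization

/-- Rex moves: composites of braid moves, i.e. of `2m`-valent vertices with vertical strands on
the left and on the right. -/
inductive IsRexMove {𝔥 : Realization cs k V} : {x y : List B} → Diag 𝔥 x y 0 → Prop
  | id (x : List B) : IsRexMove (Diag.id x)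
  | step {x z y a b : List B} {s t : B} {m : ℕ} (hst : s ≠ t) (hm : M s t = m) (hm0 : m ≠ 0)
      (hz : a ++ alt s t m ++ b = z) (hy : a ++ alt t s m ++ b = y)
      (f : Diag 𝔥 x z 0) (hf : IsRexMove f) :
      IsRexMove (Diag.comp
        (Diag.tensor (Diag.tensor (Diag.id a) (Diag.vertex s t hst hm hm0) rfl rfl rfl)
          (Diag.id b) hz hy rfl) f (by norm_num))

/-- Lower terms: linear combinations of diagrams which factor through an object `B_z` with `z` of
length smaller than `n`. -/
inductive IsLower {𝔥 : Realization cs k V} (n : ℕ) :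
    {x y : List B} → {d : ℤ} → Diag 𝔥 x y d → Prop
  | zero (x y : List B) (d : ℤ) : IsLower n (Diag.zero x y d)
  | add {x y : List B} {d : ℤ} (f g : Diag 𝔥 x y d) (hf : IsLower n f) (hg : IsLower n g) :
      IsLower n (Diag.add f g)
  | smul {x y : List B} {d : ℤ} (c : k) (f : Diag 𝔥 x y d) (hf : IsLower n f) :
      IsLower n (Diag.smul c f)
  | factor {x z y : List B} {d e d' : ℤ} (g : Diag 𝔥 z y e) (f : Diag 𝔥 x z d) (hd : e + d = d')
      (hz : z.length < n) : IsLower n (Diag.comp g f hd)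

/-- `x` is a reduced expression of the longest element of the standard parabolic subgroup
generated by the (finitely many) simple reflections in `J`, this subgroup being finite. -/
def IsLongestExpr (cs : CoxeterSystem M W) (J : Set B) (x : List B) : Prop :=
  (∀ s ∈ x, s ∈ J) ∧ cs.IsReduced x ∧
  (Subgroup.closure (cs.simple '' J) : Set W).Finite ∧
  ∀ w ∈ Subgroup.closure (cs.simple '' J), cs.length w ≤ x.length

/-! ## The relations -/

section Relations

variable [IsDomain k] [Module.Free k V] [Module.Finite k V]

open Diag in
/-- The congruence on formal diagrams which defines the morphisms of `D_BS(𝔥, W)`. -/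
inductive Rel (𝔥 : Realization cs k V) :
    {w v : List B} → {d : ℤ} → Diag 𝔥 w v d → Diag 𝔥 w v d → Prop
  -- equivalence relation, compatible with all operations
  | refl {w v : List B} {d : ℤ} (f : Diag 𝔥 w v d) : Rel 𝔥 f f
  | symm {w v : List B} {d : ℤ} {f g : Diag 𝔥 w v d} : Rel 𝔥 f g → Rel 𝔥 g f
  | trans {w v : List B} {d : ℤ} {f g h : Diag 𝔥 w v d} : Rel 𝔥 f g → Rel 𝔥 g h → Rel 𝔥 f h
  | add_congr {w v : List B} {d : ℤ} {f f' g g' : Diag 𝔥 w v d} :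
      Rel 𝔥 f f' → Rel 𝔥 g g' → Rel 𝔥 (add f g) (add f' g')
  | smul_congr {w v : List B} {d : ℤ} (c : k) {f f' : Diag 𝔥 w v d} :
      Rel 𝔥 f f' → Rel 𝔥 (smul c f) (smul c f')
  | comp_congr {w v u : List B} {d e n : ℤ} {g g' : Diag 𝔥 v u e} {f f' : Diag 𝔥 w v d}
      (hn : e + d = n) : Rel 𝔥 g g' → Rel 𝔥 f f' → Rel 𝔥 (comp g f hn) (comp g' f' hn)
  | tensor_congr {w v w' v' x y : List B} {d d' n : ℤ} {f g : Diag 𝔥 w v d}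
      {f' g' : Diag 𝔥 w' v' d'} (hx : w ++ w' = x) (hy : v ++ v' = y) (hn : d + d' = n) :
      Rel 𝔥 f g → Rel 𝔥 f' g' → Rel 𝔥 (tensor f f' hx hy hn) (tensor g g' hx hy hn)
  -- `k`-modules
  | add_assoc {w v : List B} {d : ℤ} (f g h : Diag 𝔥 w v d) :
      Rel 𝔥 (add (add f g) h) (add f (add g h))
  | add_comm {w v : List B} {d : ℤ} (f g : Diag 𝔥 w v d) : Rel 𝔥 (add f g) (add g f)
  | zero_add {w v : List B} {d : ℤ} (f : Diag 𝔥 w v d) : Rel 𝔥 (add (zero w v d) f) f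
  | one_smul {w v : List B} {d : ℤ} (f : Diag 𝔥 w v d) : Rel 𝔥 (smul 1 f) f
  | zero_smul {w v : List B} {d : ℤ} (f : Diag 𝔥 w v d) : Rel 𝔥 (smul 0 f) (zero w v d)
  | mul_smul {w v : List B} {d : ℤ} (a b : k) (f : Diag 𝔥 w v d) :
      Rel 𝔥 (smul (a * b) f) (smul a (smul b f))
  | add_smul {w v : List B} {d : ℤ} (a b : k) (f : Diag 𝔥 w v d) :
      Rel 𝔥 (smul (a + b) f) (add (smul a f) (smul b f))
  | smul_add {w v : List B} {d : ℤ} (a : k) (f g : Diag 𝔥 w v d) :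
      Rel 𝔥 (smul a (add f g)) (add (smul a f) (smul a g))
  -- bilinearity of vertical and horizontal concatenation
  | comp_add {w v u : List B} {d e n : ℤ} (g : Diag 𝔥 v u e) (f f' : Diag 𝔥 w v d)
      (hn : e + d = n) : Rel 𝔥 (comp g (add f f') hn) (add (comp g f hn) (comp g f' hn))
  | comp_smul {w v u : List B} {d e n : ℤ} (c : k) (g : Diag 𝔥 v u e) (f : Diag 𝔥 w v d)
      (hn : e + d = n) : Rel 𝔥 (comp g (smul c f) hn) (smul c (comp g f hn))
  | add_comp {w v u : List B} {d e n : ℤ} (g g' : Diag 𝔥 v u e) (f : Diag 𝔥 w v d)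
      (hn : e + d = n) : Rel 𝔥 (comp (add g g') f hn) (add (comp g f hn) (comp g' f hn))
  | smul_comp {w v u : List B} {d e n : ℤ} (c : k) (g : Diag 𝔥 v u e) (f : Diag 𝔥 w v d)
      (hn : e + d = n) : Rel 𝔥 (comp (smul c g) f hn) (smul c (comp g f hn))
  | tensor_add {w v w' v' x y : List B} {d d' n : ℤ} (f : Diag 𝔥 w v d)
      (f' g' : Diag 𝔥 w' v' d') (hx : w ++ w' = x) (hy : v ++ v' = y) (hn : d + d' = n) :
      Rel 𝔥 (tensor f (add f' g') hx hy hn) (add (tensor f f' hx hy hn) (tensor f g' hx hy hn))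
  | tensor_smul {w v w' v' x y : List B} {d d' n : ℤ} (c : k) (f : Diag 𝔥 w v d)
      (f' : Diag 𝔥 w' v' d') (hx : w ++ w' = x) (hy : v ++ v' = y) (hn : d + d' = n) :
      Rel 𝔥 (tensor f (smul c f') hx hy hn) (smul c (tensor f f' hx hy hn))
  | add_tensor {w v w' v' x y : List B} {d d' n : ℤ} (f g : Diag 𝔥 w v d)
      (f' : Diag 𝔥 w' v' d') (hx : w ++ w' = x) (hy : v ++ v' = y) (hn : d + d' = n) :
      Rel 𝔥 (tensor (add f g) f' hx hy hn) (add (tensor f f' hx hy hn) (tensor g f' hx hy hn))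
  | smul_tensor {w v w' v' x y : List B} {d d' n : ℤ} (c : k) (f : Diag 𝔥 w v d)
      (f' : Diag 𝔥 w' v' d') (hx : w ++ w' = x) (hy : v ++ v' = y) (hn : d + d' = n) :
      Rel 𝔥 (tensor (smul c f) f' hx hy hn) (smul c (tensor f f' hx hy hn))
  -- strict monoidal category
  | id_comp {w v : List B} {d : ℤ} (f : Diag 𝔥 w v d) :
      Rel 𝔥 (comp (id v) f (_root_.zero_add d)) f
  | comp_id {w v : List B} {d : ℤ} (f : Diag 𝔥 w v d) :
      Rel 𝔥 (comp f (id w) (_root_.add_zero d)) f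
  | comp_assoc {w v u x : List B} {d e c p q n : ℤ} (h : Diag 𝔥 u x c) (g : Diag 𝔥 v u e)
      (f : Diag 𝔥 w v d) (hp : c + e = p) (hq : e + d = q) (hn : p + d = n) (hn' : c + q = n) :
      Rel 𝔥 (comp (comp h g hp) f hn) (comp h (comp g f hq) hn')
  | tensor_id (w v : List B) : Rel 𝔥 (tensor (id w) (id v) rfl rfl rfl) (id (w ++ v))
  | interchange {w v u w' v' u' x y z : List B} {d e d' e' p p' q q' n : ℤ} (g : Diag 𝔥 v u e)
      (f : Diag 𝔥 w v d) (g' : Diag 𝔥 v' u' e') (f' : Diag 𝔥 w' v' d') (hx : w ++ w' = x)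
      (hy : v ++ v' = y) (hz : u ++ u' = z) (hp : e + d = p) (hp' : e' + d' = p')
      (hq : e + e' = q) (hq' : d + d' = q') (hn : p + p' = n) (hn' : q + q' = n) :
      Rel 𝔥 (tensor (comp g f hp) (comp g' f' hp') hx hz hn)
        (comp (tensor g g' hy hz hq) (tensor f f' hx hy hq') hn')
  | tensor_assoc {w v w' v' w'' v'' x y x' y' z t : List B} {d d' d'' p q n : ℤ}
      (f : Diag 𝔥 w v d) (f' : Diag 𝔥 w' v' d') (f'' : Diag 𝔥 w'' v'' d'')
      (hx : w ++ w' = x) (hy : v ++ v' = y) (hx' : w' ++ w'' = x') (hy' : v' ++ v'' = y')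
      (hz : x ++ w'' = z) (ht : y ++ v'' = t) (hz' : w ++ x' = z) (ht' : v ++ y' = t)
      (hp : d + d' = p) (hq : d' + d'' = q) (hn : p + d'' = n) (hn' : d + q = n) :
      Rel 𝔥 (tensor (tensor f f' hx hy hp) f'' hz ht hn)
        (tensor f (tensor f' f'' hx' hy' hq) hz' ht' hn')
  | nil_tensor {w v : List B} {d : ℤ} (f : Diag 𝔥 w v d) :
      Rel 𝔥 (tensor (id []) f rfl rfl (_root_.zero_add d)) f
  | tensor_nil {w v : List B} {d : ℤ} (f : Diag 𝔥 w v d) :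
      Rel 𝔥 (tensor f (id []) (List.append_nil w) (List.append_nil v) (_root_.add_zero d)) f
  -- boxes add and multiply in the obvious way
  | box_add {n : ℕ} {f g : SymmetricAlgebra k (Module.Dual k V)}
      (hf : f ∈ symDeg k (Module.Dual k V) n) (hg : g ∈ symDeg k (Module.Dual k V) n)
      (hfg : f + g ∈ symDeg k (Module.Dual k V) n) {d : ℤ} (hd : d = 2 * n) :
      Rel 𝔥 (box n (f + g) hfg hd) (add (box n f hf hd) (box n g hg hd))
  | box_smul {n : ℕ} (c : k) {f : SymmetricAlgebra k (Module.Dual k V)}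
      (hf : f ∈ symDeg k (Module.Dual k V) n) (hcf : c • f ∈ symDeg k (Module.Dual k V) n)
      {d : ℤ} (hd : d = 2 * n) :
      Rel 𝔥 (box n (c • f) hcf hd) (smul c (box n f hf hd))
  | box_mul {n m p : ℕ} {f g : SymmetricAlgebra k (Module.Dual k V)}
      (hf : f ∈ symDeg k (Module.Dual k V) n) (hg : g ∈ symDeg k (Module.Dual k V) m)
      (hfg : f * g ∈ symDeg k (Module.Dual k V) p) {d e c : ℤ} (hd : d = 2 * n) (he : e = 2 * m)
      (hc : c = 2 * p) (hdec : d + e = c) :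
      Rel 𝔥 (box p (f * g) hfg hc) (comp (box n f hf hd) (box m g hg he) hdec)
  | box_one (h1 : 1 ∈ symDeg k (Module.Dual k V) 0) (hd : (0 : ℤ) = 2 * (0 : ℕ)) :
      Rel 𝔥 (box 0 1 h1 hd) (id [])
  -- Frobenius unit (with the dot on either side)
  | split_endDot_right (s : B) :
      Rel 𝔥 (comp (tensor (id [s]) (endDot s) rfl rfl rfl) (split s) (by norm_num)) (id [s])
  | split_endDot_left (s : B) :
      Rel 𝔥 (comp (tensor (endDot s) (id [s]) rfl rfl rfl) (split s) (by norm_num)) (id [s])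
  | merge_startDot_right (s : B) :
      Rel 𝔥 (comp (merge s) (tensor (id [s]) (startDot s) rfl rfl rfl) (by norm_num)) (id [s])
  | merge_startDot_left (s : B) :
      Rel 𝔥 (comp (merge s) (tensor (startDot s) (id [s]) rfl rfl rfl) (by norm_num)) (id [s])
  -- Frobenius associativity
  | frobenius_right (s : B) :
      Rel 𝔥 (comp (tensor (id [s]) (merge s) rfl rfl rfl) (tensor (split s) (id [s]) rfl rfl rfl)
          (n := -2) (by norm_num) : Diag 𝔥 [s, s] [s, s] (-2))
        (comp (split s) (merge s) (by norm_num))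
  | frobenius_left (s : B) :
      Rel 𝔥 (comp (tensor (merge s) (id [s]) rfl rfl rfl) (tensor (id [s]) (split s) rfl rfl rfl)
          (n := -2) (by norm_num) : Diag 𝔥 [s, s] [s, s] (-2))
        (comp (split s) (merge s) (by norm_num))
  -- needle relation
  | needle (s : B) : Rel 𝔥 (comp (merge s) (split s) (n := -2) (by norm_num)) (zero [s] [s] (-2))
  -- barbell relation
  | barbell (s : B) (hs : 𝔥.rootSym s ∈ symDeg k (Module.Dual k V) 1)
      (hd : (2 : ℤ) = 2 * (1 : ℕ)) :
      Rel 𝔥 (comp (endDot s) (startDot s) (n := 2) (by norm_num)) (box 1 (𝔥.rootSym s) hs hd)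
  -- nil-Hecke relation: the polynomial `g` is the image of `f` under the Demazure operator
  | nilHecke (s : B) {n : ℕ} {f g : SymmetricAlgebra k (Module.Dual k V)}
      (hfg : f - 𝔥.reflSym s f = 𝔥.rootSym s * g)
      (hf : f ∈ symDeg k (Module.Dual k V) (n + 1))
      (hsf : 𝔥.reflSym s f ∈ symDeg k (Module.Dual k V) (n + 1))
      (hg : g ∈ symDeg k (Module.Dual k V) n) {d e : ℤ} (hd : d = 2 * (n + 1 : ℕ))
      (he : e = 2 * n) (hde : 1 + (e + 1) = d) :
      Rel 𝔥 (tensor (box (n + 1) f hf hd) (id [s]) rfl rfl (_root_.add_zero d))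
        (add (tensor (id [s]) (box (n + 1) (𝔥.reflSym s f) hsf hd) rfl rfl (_root_.zero_add d))
          (comp (startDot s) (comp (box n g hg he) (endDot s) rfl) hde))
  -- cyclicity of the `2m`-valent vertex
  | cyclic_left (s t : B) (hst : s ≠ t) (hts : t ≠ s) {n : ℕ} (hm : M s t = n + 1)
      (hm' : M t s = n + 1) :
      Rel 𝔥
        (comp
          (tensor (tensor (cap 𝔥 t) (id (alt s t n)) rfl rfl rfl) (id [altLetter s t n])
            (x := t :: (alt t s (n + 1) ++ [altLetter s t n])) rfl (alt_append s t n) rfl)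
          (comp
            (tensor (id [t]) (tensor (vertex s t hst hm n.succ_ne_zero) (id [altLetter s t n])
              rfl rfl rfl) rfl rfl rfl)
            (tensor (id (alt t s (n + 1))) (cup 𝔥 (altLetter s t n)) (List.append_nil _)
              (y := t :: (alt s t (n + 1) ++ [altLetter s t n]))
              (congrArg (List.cons t) (alt_append_append s t n _)) rfl)
            rfl)
          rfl)
        (vertex t s hts hm' n.succ_ne_zero)
  | cyclic_right (s t : B) (hst : s ≠ t) (hts : t ≠ s) {n : ℕ} (hm : M s t = n + 1)
      (hm' : M t s = n + 1) :
      Rel 𝔥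
        (comp
          (tensor (id (s :: alt t s n)) (cap 𝔥 (altLetter t s n))
            (x := s :: (alt t s (n + 1) ++ [altLetter t s n]))
            (congrArg (List.cons s) (alt_append_append t s n _)) (List.append_nil _) rfl)
          (comp
            (tensor (id [s]) (tensor (vertex s t hst hm n.succ_ne_zero) (id [altLetter t s n])
              rfl rfl rfl) rfl rfl rfl)
            (tensor (cup 𝔥 s) (id (alt t s (n + 1))) rfl
              (y := s :: (alt s t (n + 1) ++ [altLetter t s n]))
              (congrArg (fun l => s :: s :: l) (alt_append t s n).symm) rfl)
            rfl)
          rfl)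
        (vertex t s hts hm' n.succ_ne_zero)
  -- `2`-color associativity
  | two_color_assoc (s t : B) (hst : s ≠ t) {n : ℕ} (hm : M s t = n + 1) :
      Rel 𝔥
        (comp
          (tensor (id (alt t s n)) (split (altLetter t s n)) (alt_append t s n)
            (y := alt t s (n + 1) ++ [altLetter t s n]) (alt_append_append t s n _)
            (_root_.zero_add (-1)))
          (vertex s t hst hm n.succ_ne_zero) (n := -1) (by norm_num))
        (comp
          (tensor (vertex s t hst hm n.succ_ne_zero) (id [altLetter t s n]) rfl rfl rfl)
          (comp
            (tensor (id [s]) (vertex s t hst hm n.succ_ne_zero) rfl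
              (y := alt s t (n + 1) ++ [altLetter t s n])
              (congrArg (List.cons s) (alt_append t s n).symm) rfl)
            (tensor (split s) (id (alt t s n)) rfl rfl (_root_.add_zero (-1)))
            (_root_.zero_add (-1)))
          (by norm_num))
  -- Jones–Wenzl relations
  | jones_wenzl (s t : B) (hst : s ≠ t) {n : ℕ} (hm : M s t = n + 2)
      (l : List (k × List (Fin n))) (hl : IsJonesWenzl 𝔥 s t n l) :
      Rel 𝔥
        (comp
          (tensor (id (alt t s (n + 1))) (endDot (altLetter t s (n + 1))) (alt_append t s (n + 1))
            (List.append_nil _) (_root_.zero_add 1))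
          (vertex s t hst hm (n + 1).succ_ne_zero) (n := 1) (by norm_num))
        (comp (tensor (endDot s) (id (alt t s (n + 1))) rfl rfl (_root_.add_zero 1))
          (tlSum 𝔥 s t (n + 2) l) (by norm_num))
  -- Zamolodchikov relations: for a finite standard parabolic subgroup of rank `3`, two rex moves
  -- between reduced expressions of its longest element agree up to the lower terms that are
  -- prescribed by localization
  | zamolodchikov (s t u : B) (hst : s ≠ t) (htu : t ≠ u) (hsu : s ≠ u) {x y : List B}
      (hx : IsLongestExpr cs {s, t, u} x) (hy : IsLongestExpr cs {s, t, u} y)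
      (f g c : Diag 𝔥 x y 0) (hf : IsRexMove f) (hg : IsRexMove g) (hc : IsLower x.length c)
      (hloc : ∀ e ∈ allBools x.length, ∀ h ∈ allBools y.length,
        loc 𝔥 f e h = loc 𝔥 g e h + loc 𝔥 c e h) :
      Rel 𝔥 f (add g c)

end Relations

/-! ## The diagrammatic category `D_BS(𝔥, W)` -/

section Category

variable [IsDomain k] [Module.Free k V] [Module.Finite k V]

/-- The congruence on formal diagrams, as a setoid. -/
instance diagSetoid (𝔥 : Realization cs k V) (w v : List B) (d : ℤ) : Setoid (Diag 𝔥 w v d) where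
  r := Rel 𝔥
  iseqv := ⟨Rel.refl, Rel.symm, Rel.trans⟩

/-- The degree-`d` part of the graded module of morphisms from `B_w` to `B_v` in `D_BS(𝔥, W)`. -/
def Hom (𝔥 : Realization cs k V) (w v : List B) (d : ℤ) : Type _ :=
  Quotient (diagSetoid 𝔥 w v d)

namespace Hom

variable {𝔥 : Realization cs k V} {w v u x : List B} {c d e n p q : ℤ}

/-- The morphism represented by a formal combination of diagrams. -/
def mk (f : Diag 𝔥 w v d) : Hom 𝔥 w v d := Quotient.mk _ f

theorem ind {P : Hom 𝔥 w v d → Prop} (h : ∀ f, P (mk f)) (f : Hom 𝔥 w v d) : P f :=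
  Quotient.ind h f

theorem sound {f g : Diag 𝔥 w v d} (h : Rel 𝔥 f g) : mk f = mk g := Quotient.sound h

instance : Zero (Hom 𝔥 w v d) := ⟨mk (.zero w v d)⟩

instance : Add (Hom 𝔥 w v d) :=
  ⟨Quotient.map₂ Diag.add fun _ _ h _ _ h' => Rel.add_congr h h'⟩

instance : SMul k (Hom 𝔥 w v d) :=
  ⟨fun a => Quotient.map (Diag.smul a) fun _ _ h => Rel.smul_congr a h⟩

instance : Neg (Hom 𝔥 w v d) := ⟨fun f => (-1 : k) • f⟩

theorem add_comm' (f g : Hom 𝔥 w v d) : f + g = g + f := by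
  induction f using ind with | _ f
  induction g using ind with | _ g
  exact sound (Rel.add_comm f g)

theorem zero_add' (f : Hom 𝔥 w v d) : 0 + f = f := by
  induction f using ind with | _ f
  exact sound (Rel.zero_add f)

theorem one_smul' (f : Hom 𝔥 w v d) : (1 : k) • f = f := by
  induction f using ind with | _ f
  exact sound (Rel.one_smul f)

theorem zero_smul' (f : Hom 𝔥 w v d) : (0 : k) • f = 0 := by
  induction f using ind with | _ f
  exact sound (Rel.zero_smul f)

theorem add_smul' (a b : k) (f : Hom 𝔥 w v d) : (a + b) • f = a • f + b • f := by
  induction f using ind with | _ f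
  exact sound (Rel.add_smul a b f)

theorem mul_smul' (a b : k) (f : Hom 𝔥 w v d) : (a * b) • f = a • b • f := by
  induction f using ind with | _ f
  exact sound (Rel.mul_smul a b f)

instance : AddCommGroup (Hom 𝔥 w v d) where
  add_assoc f g h := by
    induction f using ind with | _ f
    induction g using ind with | _ g
    induction h using ind with | _ h
    exact sound (Rel.add_assoc f g h)
  zero_add := zero_add'
  add_zero f := by rw [add_comm', zero_add']
  neg_add_cancel f := by
    change (-1 : k) • f + f = 0
    conv_lhs => rw [← one_smul' f, ← mul_smul', ← add_smul']
    simp [zero_smul']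
  add_comm := add_comm'
  nsmul := nsmulRec
  zsmul := zsmulRec

instance : Module k (Hom 𝔥 w v d) where
  one_smul := one_smul'
  mul_smul := mul_smul'
  add_smul := add_smul'
  zero_smul := zero_smul'
  smul_zero a := by
    rw [← zero_smul' 0, ← mul_smul', mul_zero]
  smul_add a f g := by
    induction f using ind with | _ f
    induction g using ind with | _ g
    exact sound (Rel.smul_add a f g)

/-- Composition in `D_BS(𝔥, W)` (vertical concatenation). -/
def comp (hn : e + d = n) : Hom 𝔥 v u e →ₗ[k] Hom 𝔥 w v d →ₗ[k] Hom 𝔥 w u n :=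
  LinearMap.mk₂ k
    (Quotient.map₂ (fun g f => Diag.comp g f hn) fun _ _ h _ _ h' => Rel.comp_congr hn h h')
    (fun g g' f => by
      induction f using ind with | _ f
      induction g using ind with | _ g
      induction g' using ind with | _ g'
      exact sound (Rel.add_comp g g' f hn))
    (fun a g f => by
      induction f using ind with | _ f
      induction g using ind with | _ g
      exact sound (Rel.smul_comp a g f hn))
    (fun g f f' => by
      induction f using ind with | _ f
      induction f' using ind with | _ f'
      induction g using ind with | _ g
      exact sound (Rel.comp_add g f f' hn))
    (fun a g f => by
      induction f using ind with | _ f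
      induction g using ind with | _ g
      exact sound (Rel.comp_smul a g f hn))

theorem comp_mk (hn : e + d = n) (g : Diag 𝔥 v u e) (f : Diag 𝔥 w v d) :
    comp hn (mk g) (mk f) = mk (Diag.comp g f hn) := rfl

theorem comp_assoc (h : Hom 𝔥 u x c) (g : Hom 𝔥 v u e) (f : Hom 𝔥 w v d) (hp : c + e = p)
    (hq : e + d = q) (hn : p + d = n) (hn' : c + q = n) :
    comp hn (comp hp h g) f = comp hn' h (comp hq g f) := by
  induction f using ind with | _ f
  induction g using ind with | _ g
  induction h using ind with | _ h
  exact sound (Rel.comp_assoc h g f hp hq hn hn')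

/-- The identity of `B_w`. -/
def id (𝔥 : Realization cs k V) (w : List B) (hd : d = 0) : Hom 𝔥 w w d :=
  mk (hd ▸ Diag.id w)

theorem id_comp (f : Hom 𝔥 w v d) (h : e = 0) (h' : e + d = d) : comp h' (id 𝔥 v h) f = f := by
  subst h
  induction f using ind with | _ f
  exact sound (Rel.id_comp f)

theorem comp_id (f : Hom 𝔥 w v d) (h : e = 0) (h' : d + e = d) : comp h' f (id 𝔥 w h) = f := by
  subst h
  induction f using ind with | _ f
  exact sound (Rel.comp_id f)

theorem ι_mem_symDeg (k N : Type*) [CommRing k] [AddCommGroup N] [Module k N] (r : N) :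
    SymmetricAlgebra.ι k N r ∈ symDeg k N 1 := by
  rw [symDeg, pow_one]
  exact ⟨r, rfl⟩

/-- The left action of `r ∈ V^*` on morphisms: adding a box labelled `r` on the left. -/
def lmul (hn : 2 + d = n) : Module.Dual k V →ₗ[k] Hom 𝔥 w v d →ₗ[k] Hom 𝔥 w v n :=
  LinearMap.mk₂ k
    (fun r => Quotient.map
      (fun f => Diag.tensor
        (Diag.box 1 (SymmetricAlgebra.ι k _ r) (ι_mem_symDeg k _ r) (d := 2) (by norm_num))
        f rfl rfl hn)
      fun _ _ h => Rel.tensor_congr rfl rfl hn (Rel.refl _) h)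
    (fun r r' f => by
      induction f using ind with | _ f
      refine sound (Rel.trans (Rel.tensor_congr rfl rfl hn ?_ (Rel.refl f))
        (Rel.add_tensor _ _ f rfl rfl hn))
      have h := map_add (SymmetricAlgebra.ι k (Module.Dual k V)) r r'
      have h' := ι_mem_symDeg k _ (r + r')
      simp only [h] at h' ⊢
      exact Rel.box_add _ _ h' _)
    (fun a r f => by
      induction f using ind with | _ f
      refine sound (Rel.trans (Rel.tensor_congr rfl rfl hn ?_ (Rel.refl f))
        (Rel.smul_tensor _ _ f rfl rfl hn))
      have h := map_smul (SymmetricAlgebra.ι k (Module.Dual k V)) a r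
      have h' := ι_mem_symDeg k _ (a • r)
      simp only [h] at h' ⊢
      exact Rel.box_smul a _ h' _)
    (fun r f f' => by
      induction f using ind with | _ f
      induction f' using ind with | _ f'
      exact sound (Rel.tensor_add _ f f' rfl rfl hn))
    (fun a r f => by
      induction f using ind with | _ f
      exact sound (Rel.tensor_smul a _ f rfl rfl hn))

theorem lmul_comp_left (r : Module.Dual k V) (g : Hom 𝔥 v u e) (f : Hom 𝔥 w v d)
    (hp : e + d = p) (hq : 2 + e = q) (hn : 2 + p = n) (hn' : q + d = n) :
    lmul hn r (comp hp g f) = comp hn' (lmul hq r g) f := by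
  induction f using ind with | _ f
  induction g using ind with | _ g
  refine sound (Rel.trans (Rel.tensor_congr rfl rfl hn (Rel.symm (Rel.comp_id _)) (Rel.refl _)) ?_)
  refine Rel.trans (Rel.interchange _ _ g f rfl rfl rfl _ hp hq (zero_add d) hn hn') ?_
  exact Rel.comp_congr hn' (Rel.refl _) (Rel.nil_tensor f)

theorem lmul_comp_right (r : Module.Dual k V) (g : Hom 𝔥 v u e) (f : Hom 𝔥 w v d)
    (hp : e + d = p) (hq : 2 + d = q) (hn : 2 + p = n) (hn' : e + q = n) :
    lmul hn r (comp hp g f) = comp hn' g (lmul hq r f) := by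
  induction f using ind with | _ f
  induction g using ind with | _ g
  refine sound (Rel.trans (Rel.tensor_congr rfl rfl hn (Rel.symm (Rel.id_comp _)) (Rel.refl _)) ?_)
  refine Rel.trans (Rel.interchange _ _ g f rfl rfl rfl _ hp (zero_add e) hq hn hn') ?_
  exact Rel.comp_congr hn' (Rel.nil_tensor g) (Rel.refl _)

end Hom

/-! ## The additive hull -/

/-- An object of the additive hull `D_BS^⊕(𝔥, W)`: a finite formal direct sum of objects
`B_w(n)`. -/
structure Obj (B : Type*) where
  size : ℕ
  word : Fin size → List B
  deg : Fin size → ℤ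

/-- The shift `X(j)`. -/
def Obj.shift (X : Obj B) (j : ℤ) : Obj B := ⟨X.size, X.word, fun a => X.deg a + j⟩

/-- Morphisms in `D_BS^⊕(𝔥, W)`: matrices of morphisms of `D_BS(𝔥, W)`, where a morphism
`B_w(n) → B_v(m)` is an element of degree `m - n`. -/
abbrev ObjHom (𝔥 : Realization cs k V) (X Y : Obj B) : Type _ :=
  ∀ (a : Fin X.size) (b : Fin Y.size), Hom 𝔥 (X.word a) (Y.word b) (Y.deg b - X.deg a)

/-- The module of morphisms `X → Y(j)` in `D_BS^⊕(𝔥, W)`. -/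
abbrev ShHom (𝔥 : Realization cs k V) (X Y : Obj B) (j : ℤ) : Type _ :=
  ∀ (a : Fin X.size) (b : Fin Y.size), Hom 𝔥 (X.word a) (Y.word b) (Y.deg b + j - X.deg a)

theorem shHom_eq (𝔥 : Realization cs k V) (X Y : Obj B) (j : ℤ) :
    ShHom 𝔥 X Y j = ObjHom 𝔥 X (Y.shift j) := rfl

namespace ShHom

variable {𝔥 : Realization cs k V} {X Y Z T : Obj B} {i j l m n p : ℤ}

theorem comp_deg (hj : l + j = m) (a b c : ℤ) : (c + l - b) + (b + j - a) = c + m - a := by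
  omega

theorem lmul_deg (hj : 2 + j = m) (a b : ℤ) : 2 + (b + j - a) = b + m - a := by omega

/-- The composition `(g, f) ↦ g(j) • f` of `f : X → Y(j)` and `g : Y → Z(l)`. -/
def comp (hj : l + j = m) : ShHom 𝔥 Y Z l →ₗ[k] ShHom 𝔥 X Y j →ₗ[k]
    ShHom 𝔥 X Z m :=
  LinearMap.mk₂ k
    (fun g f a c => ∑ b : Fin Y.size,
      Hom.comp (comp_deg hj (X.deg a) (Y.deg b) (Z.deg c)) (g b c) (f a b))
    (fun g g' f => by
      funext a c
      simp only [Pi.add_apply, map_add, LinearMap.add_apply, Finset.sum_add_distrib])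
    (fun r g f => by
      funext a c
      simp only [Pi.smul_apply, map_smul, LinearMap.smul_apply, Finset.smul_sum])
    (fun g f f' => by
      funext a c
      simp only [Pi.add_apply, map_add, Finset.sum_add_distrib])
    (fun r g f => by
      funext a c
      simp only [Pi.smul_apply, map_smul, Finset.smul_sum])

theorem comp_apply (hj : l + j = m) (g : ShHom 𝔥 Y Z l) (f : ShHom 𝔥 X Y j)
    (a : Fin X.size) (c : Fin Z.size) : comp hj g f a c = ∑ b : Fin Y.size,
      Hom.comp (comp_deg hj (X.deg a) (Y.deg b) (Z.deg c)) (g b c) (f a b) := rfl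

theorem comp_assoc (h : ShHom 𝔥 Z T i) (g : ShHom 𝔥 Y Z l)
    (f : ShHom 𝔥 X Y j) (hp : i + l = p) (hm : l + j = m) (hn : p + j = n)
    (hn' : i + m = n) : comp hn (comp hp h g) f = comp hn' h (comp hm g f) := by
  funext a c
  simp only [comp_apply, map_sum, LinearMap.sum_apply]
  rw [Finset.sum_comm]
  exact Finset.sum_congr rfl fun _ _ => Finset.sum_congr rfl fun _ _ =>
    Hom.comp_assoc _ _ _ _ _ _ _

open Classical in
/-- The identity of `X`, as a morphism `X → X(j)` with `j = 0`. -/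
def id (𝔥 : Realization cs k V) (X : Obj B) (hj : j = 0) : ShHom 𝔥 X X j :=
  fun a b => if h : a = b then
    h ▸ Hom.id 𝔥 (X.word a) (by omega) else 0

theorem id_self (X : Obj B) (hj : j = 0) (a : Fin X.size) :
    id 𝔥 X hj a a = Hom.id 𝔥 (X.word a) (by omega) := by
  simp [id]

theorem id_ne (X : Obj B) (hj : j = 0) {a b : Fin X.size} (h : a ≠ b) : id 𝔥 X hj a b = 0 := by
  simp [id, h]

theorem id_comp (f : ShHom 𝔥 X Y j) (h : i = 0) (h' : i + j = j) :
    comp h' (id 𝔥 Y h) f = f := by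
  funext a c
  rw [comp_apply, Finset.sum_eq_single c]
  · rw [id_self]
    exact Hom.id_comp _ _ _
  · intro b _ hb
    rw [id_ne Y h hb]
    simp
  · simp

theorem comp_id (f : ShHom 𝔥 X Y j) (h : i = 0) (h' : j + i = j) :
    comp h' f (id 𝔥 X h) = f := by
  funext a c
  rw [comp_apply, Finset.sum_eq_single a]
  · rw [id_self]
    exact Hom.comp_id _ _ _
  · intro b _ hb
    rw [id_ne X h (Ne.symm hb)]
    simp
  · simp

/-- The left action of `r ∈ V^*`. -/
def lmul (hj : 2 + j = m) : Module.Dual k V →ₗ[k] ShHom 𝔥 X Y j →ₗ[k]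
    ShHom 𝔥 X Y m :=
  LinearMap.mk₂ k (fun r f a b => Hom.lmul (lmul_deg hj (X.deg a) (Y.deg b)) r (f a b))
    (fun r r' f => by funext a b; simp)
    (fun c r f => by funext a b; simp)
    (fun r f f' => by funext a b; simp)
    (fun c r f => by funext a b; simp)

theorem lmul_apply (hj : 2 + j = m) (r : Module.Dual k V) (f : ShHom 𝔥 X Y j)
    (a : Fin X.size) (b : Fin Y.size) :
    lmul hj r f a b = Hom.lmul (lmul_deg hj (X.deg a) (Y.deg b)) r (f a b) := rfl

theorem lmul_comp_left (r : Module.Dual k V) (g : ShHom 𝔥 Y Z l)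
    (f : ShHom 𝔥 X Y j) (hp : l + j = p) (hm : 2 + l = m) (hn : 2 + p = n)
    (hn' : m + j = n) : lmul hn r (comp hp g f) = comp hn' (lmul hm r g) f := by
  funext a c
  simp only [comp_apply, lmul_apply, map_sum]
  exact Finset.sum_congr rfl fun _ _ => Hom.lmul_comp_left _ _ _ _ _ _ _

theorem lmul_comp_right (r : Module.Dual k V) (g : ShHom 𝔥 Y Z l)
    (f : ShHom 𝔥 X Y j) (hp : l + j = p) (hm : 2 + j = m) (hn : 2 + p = n)
    (hn' : l + m = n) : lmul hn r (comp hp g f) = comp hn' g (lmul hm r f) := by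
  funext a c
  simp only [comp_apply, lmul_apply, map_sum]
  exact Finset.sum_congr rfl fun _ _ => Hom.lmul_comp_right _ _ _ _ _ _ _

end ShHom

/-! ## Sequences and biequivariant morphisms -/

/-- A `D_BS^⊕`-sequence: a sequence of objects, all but finitely many of which are zero (that is,
empty direct sums). -/
structure DSeq (B : Type*) where
  obj : ℤ → Obj B
  finite_support : {i | (obj i).size ≠ 0}.Finite

/-- The part of bidegree `(i, j)` of `uHom_BE(F, G)`: the product over all `p, q` with
`q - p = i - j` of the modules of morphisms `F^p → G^q(j)`. -/
abbrev BEDeg (𝔥 : Realization cs k V) (F G : DSeq B) (i j : ℤ) : Type _ :=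
  ∀ pq : {pq : ℤ × ℤ // pq.2 - pq.1 = i - j}, ShHom 𝔥 (F.obj pq.1.1) (G.obj pq.1.2) j

instance (𝔥 : Realization cs k V) (F G : DSeq B) (i j : ℤ) : AddCommMonoid (BEDeg 𝔥 F G i j) :=
  Pi.addCommMonoid

instance (𝔥 : Realization cs k V) (F G : DSeq B) (i j : ℤ) : AddCommGroup (BEDeg 𝔥 F G i j) :=
  Pi.addCommGroup

instance (𝔥 : Realization cs k V) (F G : DSeq B) (i j : ℤ) : Module k (BEDeg 𝔥 F G i j) :=
  Pi.module _ _ _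

namespace BEDeg

variable {𝔥 : Realization cs k V} {F G H K : DSeq B} {i i' i'' j j' j'' m m' n n' p p' : ℤ}

/-- Composition of homogeneous elements. -/
def comp (hi : i' + i = m) (hj : j' + j = n) :
    BEDeg 𝔥 G H i' j' →ₗ[k] BEDeg 𝔥 F G i j →ₗ[k] BEDeg 𝔥 F H m n :=
  LinearMap.mk₂ k
    (fun g f pr => ShHom.comp hj
      (g ⟨(pr.1.1 + (i - j), pr.1.2), by have := pr.2; dsimp only; omega⟩)
      (f ⟨(pr.1.1, pr.1.1 + (i - j)), by dsimp only; omega⟩))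
    (fun g g' f => by funext pr; simp only [Pi.add_apply, map_add, LinearMap.add_apply])
    (fun c g f => by funext pr; simp only [Pi.smul_apply, map_smul, LinearMap.smul_apply])
    (fun g f f' => by funext pr; simp only [Pi.add_apply, map_add])
    (fun c g f => by funext pr; simp only [Pi.smul_apply, map_smul])

theorem comp_apply (hi : i' + i = m) (hj : j' + j = n) (g : BEDeg 𝔥 G H i' j')
    (f : BEDeg 𝔥 F G i j) (p q r : ℤ) (hq : q - p = i - j) (hqr : r - q = i' - j')
    (hpr : r - p = m - n) :
    comp hi hj g f ⟨(p, r), hpr⟩ = ShHom.comp hj (g ⟨(q, r), hqr⟩) (f ⟨(p, q), hq⟩) := by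
  obtain rfl : q = p + (i - j) := by omega
  rfl

theorem comp_assoc (h : BEDeg 𝔥 H K i'' j'') (g : BEDeg 𝔥 G H i' j') (f : BEDeg 𝔥 F G i j)
    (hm : i'' + i' = m) (hn : j'' + j' = n) (hm' : i' + i = m') (hn' : j' + j = n')
    (hp : m + i = p) (hq : n + j = p') (hp' : i'' + m' = p) (hq' : j'' + n' = p') :
    comp hp hq (comp hm hn h g) f = comp hp' hq' h (comp hm' hn' g f) := by
  funext ⟨⟨a, d⟩, had⟩
  dsimp only at had
  rw [comp_apply hp hq _ _ a (a + (i - j)) d (by omega) (by omega) had,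
    comp_apply hm hn _ _ (a + (i - j)) (a + (i - j) + (i' - j')) d (by omega) (by omega) (by omega),
    comp_apply hp' hq' _ _ a (a + (i - j) + (i' - j')) d (by omega) (by omega) had,
    comp_apply hm' hn' _ _ a (a + (i - j)) (a + (i - j) + (i' - j')) (by omega) (by omega)
      (by omega)]
  exact ShHom.comp_assoc _ _ _ _ _ _ _

/-- The identity of `F`. -/
def id (𝔥 : Realization cs k V) (F : DSeq B) : BEDeg 𝔥 F F 0 0 := fun pq =>
  (show pq.1.1 = pq.1.2 by have := pq.2; omega) ▸ ShHom.id 𝔥 (F.obj pq.1.1) rfl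

theorem id_comp (f : BEDeg 𝔥 F G i j) (hi : 0 + i = i) (hj : 0 + j = j) :
    comp hi hj (id 𝔥 G) f = f := by
  funext ⟨⟨a, b⟩, hab⟩
  dsimp only at hab
  rw [comp_apply hi hj _ _ a b b hab (by omega) hab]
  exact ShHom.id_comp _ rfl _

theorem comp_id (f : BEDeg 𝔥 F G i j) (hi : i + 0 = i) (hj : j + 0 = j) :
    comp hi hj f (id 𝔥 F) = f := by
  funext ⟨⟨a, b⟩, hab⟩
  dsimp only at hab
  rw [comp_apply hi hj _ _ a a b (by omega) hab hab]
  exact ShHom.comp_id _ rfl _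

/-- The left action of `r ∈ V^* = R^2_2` on homogeneous elements. -/
def lmul (hi : 2 + i = m) (hj : 2 + j = n) :
    Module.Dual k V →ₗ[k] BEDeg 𝔥 F G i j →ₗ[k] BEDeg 𝔥 F G m n :=
  LinearMap.mk₂ k
    (fun r f pq => ShHom.lmul hj r (f ⟨pq.1, by have := pq.2; omega⟩))
    (fun r r' f => by funext pr; simp only [Pi.add_apply, map_add, LinearMap.add_apply])
    (fun c r f => by funext pr; simp only [Pi.smul_apply, map_smul, LinearMap.smul_apply])
    (fun r f f' => by funext pr; simp only [Pi.add_apply, map_add])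
    (fun c r f => by funext pr; simp only [Pi.smul_apply, map_smul])

theorem lmul_apply (hi : 2 + i = m) (hj : 2 + j = n) (r : Module.Dual k V) (f : BEDeg 𝔥 F G i j)
    (p q : ℤ) (h : q - p = m - n) (h' : q - p = i - j) :
    lmul hi hj r f ⟨(p, q), h⟩ = ShHom.lmul hj r (f ⟨(p, q), h'⟩) := rfl

theorem lmul_comp_left (r : Module.Dual k V) (g : BEDeg 𝔥 G H i' j') (f : BEDeg 𝔥 F G i j)
    (hm : i' + i = m) (hn : j' + j = n) (hm' : 2 + i' = m') (hn' : 2 + j' = n') (hp : 2 + m = p)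
    (hp' : 2 + n = p') (hq : m' + i = p) (hq' : n' + j = p') :
    lmul hp hp' r (comp hm hn g f) = comp hq hq' (lmul hm' hn' r g) f := by
  funext ⟨⟨a, c⟩, hac⟩
  dsimp only at hac
  rw [lmul_apply hp hp' _ _ a c hac (by omega),
    comp_apply hm hn _ _ a (a + (i - j)) c (by omega) (by omega) (by omega),
    comp_apply hq hq' _ _ a (a + (i - j)) c (by omega) (by omega) hac,
    lmul_apply hm' hn' _ _ _ _ _ (by omega)]
  exact ShHom.lmul_comp_left _ _ _ _ _ _ _

theorem lmul_comp_right (r : Module.Dual k V) (g : BEDeg 𝔥 G H i' j') (f : BEDeg 𝔥 F G i j)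
    (hm : i' + i = m) (hn : j' + j = n) (hm' : 2 + i = m') (hn' : 2 + j = n') (hp : 2 + m = p)
    (hp' : 2 + n = p') (hq : i' + m' = p) (hq' : j' + n' = p') :
    lmul hp hp' r (comp hm hn g f) = comp hq hq' g (lmul hm' hn' r f) := by
  funext ⟨⟨a, c⟩, hac⟩
  dsimp only at hac
  rw [lmul_apply hp hp' _ _ a c hac (by omega),
    comp_apply hm hn _ _ a (a + (i - j)) c (by omega) (by omega) (by omega),
    comp_apply hq hq' _ _ a (a + (i - j)) c (by omega) (by omega) hac,
    lmul_apply hm' hn' _ _ _ _ _ (by omega)]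
  exact ShHom.lmul_comp_right _ _ _ _ _ _ _

end BEDeg

/-- The bigraded module `uHom_BE(F, G)`. -/
abbrev BE (𝔥 : Realization cs k V) (F G : DSeq B) : Type _ :=
  ⨁ ij : ℤ × ℤ, BEDeg 𝔥 F G ij.1 ij.2

instance (𝔥 : Realization cs k V) (F G : DSeq B) : AddCommMonoid (BE 𝔥 F G) :=
  inferInstance

instance (𝔥 : Realization cs k V) (F G : DSeq B) : AddCommGroup (BE 𝔥 F G) :=
  inferInstance

instance (𝔥 : Realization cs k V) (F G : DSeq B) : Module k (BE 𝔥 F G) :=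
  inferInstance

namespace BE

variable {𝔥 : Realization cs k V} {F G H K : DSeq B}

/-- The inclusion of the part of bidegree `(i, j)`. -/
abbrev of (𝔥 : Realization cs k V) (F G : DSeq B) (i j : ℤ) : BEDeg 𝔥 F G i j →ₗ[k] BE 𝔥 F G :=
  DirectSum.lof k (ℤ × ℤ) (fun ij => BEDeg 𝔥 F G ij.1 ij.2) (i, j)

/-- Composition `uHom_BE(G, H) ⊗ uHom_BE(F, G) → uHom_BE(F, H)`. -/
def comp : BE 𝔥 G H →ₗ[k] BE 𝔥 F G →ₗ[k] BE 𝔥 F H :=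
  DirectSum.toModule k _ _ fun ij => LinearMap.flip <| DirectSum.toModule k _ _ fun ij' =>
    LinearMap.flip <| (BEDeg.comp rfl rfl).compr₂ (of 𝔥 F H (ij.1 + ij'.1) (ij.2 + ij'.2))

theorem comp_of {i i' j j' m n : ℤ} (hm : i' + i = m) (hn : j' + j = n) (g : BEDeg 𝔥 G H i' j')
    (f : BEDeg 𝔥 F G i j) :
    comp (of 𝔥 G H i' j' g) (of 𝔥 F G i j f) = of 𝔥 F H m n (BEDeg.comp hm hn g f) := by
  subst hm hn
  simp [comp, of]

theorem induction {P : BE 𝔥 F G → Prop} (f : BE 𝔥 F G) (zero : P 0)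
    (add : ∀ f g, P f → P g → P (f + g)) (hof : ∀ i j f, P (of 𝔥 F G i j f)) : P f :=
  DirectSum.induction_on f zero (fun ij f => hof ij.1 ij.2 f) add

theorem comp_assoc (h : BE 𝔥 H K) (g : BE 𝔥 G H) (f : BE 𝔥 F G) :
    comp (comp h g) f = comp h (comp g f) := by
  induction h using induction with
  | zero => simp
  | add h h' ih ih' => simp only [map_add, LinearMap.add_apply, ih, ih']
  | hof i'' j'' h =>
  induction g using induction with
  | zero => simp
  | add g g' ih ih' => simp only [map_add, LinearMap.add_apply, ih, ih']
  | hof i' j' g =>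
  induction f using induction with
  | zero => simp
  | add f f' ih ih' => simp only [map_add, ih, ih']
  | hof i j f =>
  rw [comp_of rfl rfl, comp_of rfl rfl, comp_of rfl rfl,
    comp_of (add_assoc i'' i' i).symm (add_assoc j'' j' j).symm]
  exact congrArg _ (BEDeg.comp_assoc _ _ _ _ _ _ _ _ _ _ _)

/-- The identity of `F`, of bidegree `(0, 0)`. -/
def id (𝔥 : Realization cs k V) (F : DSeq B) : BE 𝔥 F F := of 𝔥 F F 0 0 (BEDeg.id 𝔥 F)

theorem id_comp (f : BE 𝔥 F G) : comp (id 𝔥 G) f = f := by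
  induction f using induction with
  | zero => simp
  | add f f' ih ih' => simp only [map_add, ih, ih']
  | hof i j f =>
  rw [id, comp_of (zero_add i) (zero_add j), BEDeg.id_comp]

theorem comp_id (f : BE 𝔥 F G) : comp f (id 𝔥 F) = f := by
  induction f using induction with
  | zero => simp
  | add f f' ih ih' => simp only [map_add, LinearMap.add_apply, ih, ih']
  | hof i j f =>
  rw [id, comp_of (add_zero i) (add_zero j), BEDeg.comp_id]

/-- The left action of `r ∈ V^*` on `uHom_BE(F, G)`, i.e. `f ↦ r ⋆ f`. -/
def lmul : Module.Dual k V →ₗ[k] BE 𝔥 F G →ₗ[k] BE 𝔥 F G :=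
  LinearMap.flip <| DirectSum.toModule k _ _ fun ij =>
    LinearMap.flip <| (BEDeg.lmul rfl rfl).compr₂ (of 𝔥 F G (2 + ij.1) (2 + ij.2))

theorem lmul_of {i j m n : ℤ} (hm : 2 + i = m) (hn : 2 + j = n) (r : Module.Dual k V)
    (f : BEDeg 𝔥 F G i j) : lmul r (of 𝔥 F G i j f) = of 𝔥 F G m n (BEDeg.lmul hm hn r f) := by
  subst hm hn
  simp [lmul, of]

theorem lmul_comp_left (r : Module.Dual k V) (g : BE 𝔥 G H) (f : BE 𝔥 F G) :
    lmul r (comp g f) = comp (lmul r g) f := by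
  induction g using induction with
  | zero => simp
  | add g g' ih ih' => simp only [map_add, LinearMap.add_apply, ih, ih']
  | hof i' j' g =>
  induction f using induction with
  | zero => simp
  | add f f' ih ih' => simp only [map_add, ih, ih']
  | hof i j f =>
  rw [comp_of rfl rfl, lmul_of rfl rfl, lmul_of rfl rfl,
    comp_of (add_assoc 2 i' i) (add_assoc 2 j' j)]
  exact congrArg _ (BEDeg.lmul_comp_left _ _ _ _ _ _ _ _ _ _ _)

theorem lmul_comp_right (r : Module.Dual k V) (g : BE 𝔥 G H) (f : BE 𝔥 F G) :
    lmul r (comp g f) = comp g (lmul r f) := by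
  induction g using induction with
  | zero => simp
  | add g g' ih ih' => simp only [map_add, LinearMap.add_apply, ih, ih']
  | hof i' j' g =>
  induction f using induction with
  | zero => simp
  | add f f' ih ih' => simp only [map_add, ih, ih']
  | hof i j f =>
  rw [comp_of rfl rfl, lmul_of rfl rfl, lmul_of rfl rfl,
    comp_of (m := 2 + (i' + i)) (n := 2 + (j' + j)) (by omega) (by omega)]
  exact congrArg _ (BEDeg.lmul_comp_right _ _ _ _ _ _ _ _ _ _ _)

/-- The operator acting by `(-1)^i` in cohomological degree `i`. -/
def sgn : BE 𝔥 F G →ₗ[k] BE 𝔥 F G :=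
  DirectSum.toModule k _ _ fun ij => (ij.1.negOnePow : ℤ) • of 𝔥 F G ij.1 ij.2

theorem sgn_of (i j : ℤ) (f : BEDeg 𝔥 F G i j) :
    sgn (of 𝔥 F G i j f) = (i.negOnePow : ℤ) • of 𝔥 F G i j f := by
  simp [sgn, of]

end BE

/-! ## Left-monodromic morphisms -/

/-- The exterior algebra `Λ` of `V^*`; the part `⋀^n V^*` has bidegree `(n, 2n)`. -/
abbrev Lam (k V : Type*) [CommRing k] [AddCommGroup V] [Module k V] : Type _ :=
  ExteriorAlgebra k (Module.Dual k V)

/-- The involution of `Λ` acting by `(-1)^n` on `⋀^n V^*`. -/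
abbrev lamSgn (k V : Type*) [CommRing k] [AddCommGroup V] [Module k V] : Lam k V ≃ₐ[k] Lam k V :=
  CliffordAlgebra.involuteEquiv

/-- The contraction of elements of `Λ` with `x ∈ V`. -/
def contract (x : V) : Lam k V →ₗ[k] Lam k V :=
  CliffordAlgebra.contractLeft (Module.Dual.eval k V x)

/-- The bigraded module `uHom_LM(F, G) = Λ ⊗ uHom_BE(F, G)`. -/
abbrev LM (𝔥 : Realization cs k V) (F G : DSeq B) : Type _ := Lam k V ⊗[k] BE 𝔥 F G

instance (𝔥 : Realization cs k V) (F G : DSeq B) : AddCommMonoid (LM 𝔥 F G) :=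
  TensorProduct.addCommMonoid

instance (𝔥 : Realization cs k V) (F G : DSeq B) : AddCommGroup (LM 𝔥 F G) :=
  TensorProduct.addCommGroup

instance (𝔥 : Realization cs k V) (F G : DSeq B) : Module k (LM 𝔥 F G) :=
  TensorProduct.leftModule

namespace LM

variable {𝔥 : Realization cs k V} {F G H K : DSeq B}

/-- The part of bidegree `(i, j)` of `uHom_LM(F, G)`. -/
def bideg (𝔥 : Realization cs k V) (F G : DSeq B) (i j : ℤ) : Submodule k (LM 𝔥 F G) :=
  Submodule.span k {z | ∃ (n : ℕ) (r : Lam k V) (a b : ℤ) (f : BEDeg 𝔥 F G a b),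
    r ∈ ⋀[k]^n (Module.Dual k V) ∧ n + a = i ∧ 2 * n + b = j ∧ z = r ⊗ₜ[k] BE.of 𝔥 F G a b f}

/-- Composition in `uHom_LM`: `(r ⊗ f) ∘ (s ⊗ g) = (-1)^{|f||s|} (r ∧ s) ⊗ (f ∘ g)`. -/
def comp : LM 𝔥 G H →ₗ[k] LM 𝔥 F G →ₗ[k] LM 𝔥 F H :=
  TensorProduct.lift <| LinearMap.flip <| DirectSum.toModule k _ _ fun ij => LinearMap.flip <|
    TensorProduct.curry <| TensorProduct.map₂
      ((LinearMap.mul k (Lam k V)).compl₂ (lamSgn k V ^ ij.1).toLinearMap)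
      (BE.comp ∘ₗ BE.of 𝔥 G H ij.1 ij.2)

theorem comp_tmul (i j : ℤ) (r s : Lam k V) (g : BEDeg 𝔥 G H i j) (f : BE 𝔥 F G) :
    comp (r ⊗ₜ[k] BE.of 𝔥 G H i j g) (s ⊗ₜ[k] f) =
      (r * (lamSgn k V ^ i) s) ⊗ₜ[k] BE.comp (BE.of 𝔥 G H i j g) f := by
  simp [comp, BE.of]

theorem induction {P : LM 𝔥 F G → Prop} (f : LM 𝔥 F G) (zero : P 0)
    (add : ∀ f g, P f → P g → P (f + g))
    (tmul : ∀ r i j f, P (r ⊗ₜ[k] BE.of 𝔥 F G i j f)) : P f := by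
  induction f using TensorProduct.induction_on with
  | zero => exact zero
  | add f g hf hg => exact add f g hf hg
  | tmul r f =>
  induction f using BE.induction with
  | zero => rw [TensorProduct.tmul_zero]; exact zero
  | add f g hf hg => rw [TensorProduct.tmul_add]; exact add _ _ hf hg
  | hof i j f => exact tmul r i j f

theorem comp_assoc (h : LM 𝔥 H K) (g : LM 𝔥 G H) (f : LM 𝔥 F G) :
    comp (comp h g) f = comp h (comp g f) := by
  induction h using induction with
  | zero => simp
  | add h h' ih ih' => simp only [map_add, LinearMap.add_apply, ih, ih']
  | tmul r i'' j'' h =>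
  induction g using induction with
  | zero => simp
  | add g g' ih ih' => simp only [map_add, LinearMap.add_apply, ih, ih']
  | tmul s i' j' g =>
  induction f using induction with
  | zero => simp
  | add f f' ih ih' => simp only [map_add, ih, ih']
  | tmul t i j f =>
  rw [comp_tmul, BE.comp_of rfl rfl, comp_tmul, comp_tmul, comp_tmul,
    ← BE.comp_of rfl rfl h g, BE.comp_assoc, map_mul, zpow_add, AlgEquiv.mul_apply, mul_assoc]

/-- The identity of `F`. -/
def id (𝔥 : Realization cs k V) (F : DSeq B) : LM 𝔥 F F := 1 ⊗ₜ[k] BE.id 𝔥 F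

theorem id_comp (f : LM 𝔥 F G) : comp (id 𝔥 G) f = f := by
  induction f using induction with
  | zero => simp
  | add f f' ih ih' => simp only [map_add, ih, ih']
  | tmul r i j f =>
  rw [id, BE.id, comp_tmul, ← BE.id, BE.id_comp, zpow_zero, AlgEquiv.one_apply, one_mul]

theorem comp_id (f : LM 𝔥 F G) : comp f (id 𝔥 F) = f := by
  induction f using induction with
  | zero => simp
  | add f f' ih ih' => simp only [map_add, LinearMap.add_apply, ih, ih']
  | tmul r i j f =>
  rw [id, comp_tmul, BE.comp_id, map_one, mul_one]

/-- The operator acting by `(-1)^i` in cohomological degree `i`. -/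
def sgn : LM 𝔥 F G →ₗ[k] LM 𝔥 F G := TensorProduct.map (lamSgn k V).toLinearMap BE.sgn

/-- The map `κ`, written with the help of a basis `(b_a)` of `V` and its dual basis `(b_a^*)` as
`κ(r ⊗ f) = ∑_a (b_a ⌢ r) ⊗ (b_a^* ⋆ f)`. -/
def kappa : LM 𝔥 F G →ₗ[k] LM 𝔥 F G :=
  ∑ a, TensorProduct.map (contract (Module.Free.chooseBasis k V a))
    (BE.lmul ((Module.Free.chooseBasis k V).coord a))

/-- The contraction of elements of `uHom_LM(F, G)` with `x ∈ V`. -/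
def frown (x : V) : LM 𝔥 F G →ₗ[k] LM 𝔥 F G := TensorProduct.map (contract x) LinearMap.id

theorem kappa_tmul (r : Lam k V) (f : BE 𝔥 F G) : kappa (r ⊗ₜ[k] f) =
    ∑ a, contract (Module.Free.chooseBasis k V a) r ⊗ₜ[k]
      BE.lmul ((Module.Free.chooseBasis k V).coord a) f := by
  simp [kappa, LinearMap.sum_apply]

theorem kappa_one_tmul (f : BE 𝔥 F G) : kappa ((1 : Lam k V) ⊗ₜ[k] f) = 0 := by
  simp [kappa_tmul, contract]

/-- Together with `kappa_one_tmul`, this recursion shows that `κ` does not depend on the choice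
of the basis and that `κ ((r_1 ∧ ⋯ ∧ r_n) ⊗ f)` is the alternating sum over `i` of
`(r_1 ∧ ⋯ r̂_i ⋯ ∧ r_n) ⊗ (r_i ⋆ f)`. -/
theorem kappa_ι_mul_tmul (r : Module.Dual k V) (s : Lam k V) (f : BE 𝔥 F G) :
    kappa ((ExteriorAlgebra.ι k r * s) ⊗ₜ[k] f) = s ⊗ₜ[k] BE.lmul r f -
      TensorProduct.map (LinearMap.mulLeft k (ExteriorAlgebra.ι k r)) LinearMap.id
        (kappa (s ⊗ₜ[k] f)) := by
  have h : r = ∑ a, r (Module.Free.chooseBasis k V a) • (Module.Free.chooseBasis k V).coord a :=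
    (Module.Free.chooseBasis k V).ext fun c => by
      simp
  have h' : ∀ a, contract (Module.Free.chooseBasis k V a) (ExteriorAlgebra.ι k r * s) =
      r (Module.Free.chooseBasis k V a) • s -
        ExteriorAlgebra.ι k r * contract (Module.Free.chooseBasis k V a) s := fun a =>
    CliffordAlgebra.contractLeft_ι_mul _ _ _
  conv_rhs => enter [1]; rw [h]
  simp only [kappa_tmul, h', TensorProduct.sub_tmul, Finset.sum_sub_distrib, map_sum, map_smul,
    TensorProduct.map_tmul, LinearMap.mulLeft_apply, LinearMap.id_apply, LinearMap.sum_apply,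
    LinearMap.smul_apply, TensorProduct.tmul_sum, TensorProduct.smul_tmul]

theorem contract_mul (x : V) (r s : Lam k V) :
    contract x (r * s) = contract x r * s + lamSgn k V r * contract x s := by
  induction r using CliffordAlgebra.left_induction with
  | algebraMap c =>
    rw [AlgEquiv.commutes]
    simp only [contract, CliffordAlgebra.contractLeft_algebraMap_mul,
      CliffordAlgebra.contractLeft_algebraMap, zero_mul, zero_add]
  | add r r' hr hr' => rw [add_mul, map_add, hr, hr', map_add, map_add]; noncomm_ring
  | ι_mul r m hr =>
    have e : ∀ t : Lam k V, contract x (CliffordAlgebra.ι 0 m * t) =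
        m x • t - CliffordAlgebra.ι 0 m * contract x t := fun t =>
      CliffordAlgebra.contractLeft_ι_mul _ _ _
    rw [mul_assoc, e, hr, e, map_mul]
    have e' : lamSgn k V (CliffordAlgebra.ι 0 m) = -CliffordAlgebra.ι 0 m :=
      CliffordAlgebra.involute_ι m
    rw [e']
    simp only [sub_mul, mul_add, smul_mul_assoc, neg_mul, mul_assoc]
    abel

theorem contract_lamSgn (x : V) (r : Lam k V) :
    contract x (lamSgn k V r) = -lamSgn k V (contract x r) := by
  induction r using CliffordAlgebra.left_induction with
  | algebraMap c =>
    rw [AlgEquiv.commutes]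
    simp only [contract, CliffordAlgebra.contractLeft_algebraMap, map_zero, neg_zero]
  | add r r' hr hr' => simp only [map_add, hr, hr']; abel
  | ι_mul r m hr =>
    have e : ∀ t : Lam k V, contract x (CliffordAlgebra.ι 0 m * t) =
        m x • t - CliffordAlgebra.ι 0 m * contract x t := fun t =>
      CliffordAlgebra.contractLeft_ι_mul _ _ _
    have e' : lamSgn k V (CliffordAlgebra.ι 0 m) = -CliffordAlgebra.ι 0 m :=
      CliffordAlgebra.involute_ι m
    rw [map_mul, e', neg_mul, map_neg, e, hr, e, map_sub, map_smul, map_mul, e']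
    simp only [mul_neg, neg_mul, sub_neg_eq_add]

theorem lamSgn_lamSgn (r : Lam k V) : lamSgn k V (lamSgn k V r) = r :=
  CliffordAlgebra.involute_involute r

theorem lamSgn_zpow_two_add (i : ℤ) (r : Lam k V) :
    (lamSgn k V ^ (2 + i)) r = (lamSgn k V ^ i) r := by
  rw [zpow_add, AlgEquiv.mul_apply, zpow_two, AlgEquiv.mul_apply, lamSgn_lamSgn]

theorem contract_lamSgn_zpow (x : V) (i : ℤ) (r : Lam k V) :
    contract x ((lamSgn k V ^ i) r) = (i.negOnePow : ℤ) • (lamSgn k V ^ i) (contract x r) := by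
  induction i using Int.induction_on generalizing r with
  | zero => simp
  | succ i ih =>
    rw [zpow_add, zpow_one, AlgEquiv.mul_apply, ih, contract_lamSgn, Int.negOnePow_succ]
    simp
  | pred i ih =>
    have e : (lamSgn k V ^ (-(i : ℤ) - 1)) = lamSgn k V ^ (-(i : ℤ) + 1) := by
      ext t
      rw [← lamSgn_zpow_two_add (-(i : ℤ) - 1)]
      congr 2
      ring
    rw [e, zpow_add, zpow_one, AlgEquiv.mul_apply, ih, contract_lamSgn, Int.negOnePow_sub]
    simp

theorem sgn_tmul (r : Lam k V) (i j : ℤ) (f : BEDeg 𝔥 F G i j) :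
    sgn (r ⊗ₜ[k] BE.of 𝔥 F G i j f) =
      (i.negOnePow : ℤ) • (lamSgn k V r ⊗ₜ[k] BE.of 𝔥 F G i j f) := by
  rw [sgn, TensorProduct.map_tmul, BE.sgn_of, TensorProduct.tmul_smul]
  rfl

theorem kappa_comp (g : LM 𝔥 G H) (f : LM 𝔥 F G) :
    kappa (comp g f) = comp (kappa g) f + comp (sgn g) (kappa f) := by
  induction g using induction with
  | zero => simp
  | add g g' ih ih' => simp only [map_add, LinearMap.add_apply, ih, ih']; abel
  | tmul r i' j' g =>
  induction f using induction with
  | zero => simp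
  | add f f' ih ih' => simp only [map_add, ih, ih']; abel
  | tmul s i j f =>
  have e1 : ∀ (t : Lam k V) (r' : Module.Dual k V),
      comp (t ⊗ₜ[k] BE.lmul r' (BE.of 𝔥 G H i' j' g)) (s ⊗ₜ[k] BE.of 𝔥 F G i j f) =
        (t * (lamSgn k V ^ i') s) ⊗ₜ[k]
          BE.lmul r' (BE.comp (BE.of 𝔥 G H i' j' g) (BE.of 𝔥 F G i j f)) := by
    intro t r'
    rw [BE.lmul_comp_left, BE.lmul_of rfl rfl, comp_tmul, lamSgn_zpow_two_add]
  have e2 : ∀ (t : Lam k V) (r' : Module.Dual k V),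
      comp (sgn (r ⊗ₜ[k] BE.of 𝔥 G H i' j' g)) (t ⊗ₜ[k] BE.lmul r' (BE.of 𝔥 F G i j f)) =
        (lamSgn k V r * ((i'.negOnePow : ℤ) • (lamSgn k V ^ i') t)) ⊗ₜ[k]
          BE.lmul r' (BE.comp (BE.of 𝔥 G H i' j' g) (BE.of 𝔥 F G i j f)) := by
    intro t r'
    rw [BE.lmul_comp_right, sgn_tmul, map_zsmul, LinearMap.smul_apply, comp_tmul, mul_smul_comm]
    rfl
  rw [comp_tmul, kappa_tmul, kappa_tmul, kappa_tmul, map_sum, map_sum, LinearMap.sum_apply,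
    ← Finset.sum_add_distrib]
  refine Finset.sum_congr rfl fun a _ => ?_
  rw [e1, e2, contract_mul, contract_lamSgn_zpow, TensorProduct.add_tmul]

theorem sgn_comp (g : LM 𝔥 G H) (f : LM 𝔥 F G) : sgn (comp g f) = comp (sgn g) (sgn f) := by
  induction g using induction with
  | zero => simp
  | add g g' ih ih' => simp only [map_add, LinearMap.add_apply, ih, ih']
  | tmul r i' j' g =>
  induction f using induction with
  | zero => simp
  | add f f' ih ih' => simp only [map_add, ih, ih']
  | tmul s i j f =>
  rw [comp_tmul, BE.comp_of rfl rfl, sgn_tmul, sgn_tmul, sgn_tmul, map_zsmul, map_zsmul,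
    LinearMap.smul_apply, comp_tmul, BE.comp_of rfl rfl, map_mul, Int.negOnePow_add,
    ← AlgEquiv.mul_apply, ← AlgEquiv.mul_apply, ← zpow_one_add, ← zpow_add_one, add_comm 1 i',
    smul_smul, Units.val_mul, mul_comm]

theorem sgn_sgn (f : LM 𝔥 F G) : sgn (sgn f) = f := by
  induction f using induction with
  | zero => simp
  | add f f' ih ih' => simp only [map_add, ih, ih']
  | tmul r i j f =>
  rw [sgn_tmul, map_zsmul, sgn_tmul, lamSgn_lamSgn, smul_smul, ← Units.val_mul,
    Int.units_mul_self, Units.val_one, one_smul]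

theorem kappa_sgn (f : LM 𝔥 F G) : kappa (sgn f) = -sgn (kappa f) := by
  induction f using induction with
  | zero => simp
  | add f f' ih ih' => simp only [map_add, ih, ih']; abel
  | tmul r i j f =>
  rw [sgn_tmul, map_zsmul, kappa_tmul, kappa_tmul, map_sum, Finset.smul_sum,
    ← Finset.sum_neg_distrib]
  refine Finset.sum_congr rfl fun a _ => ?_
  rw [contract_lamSgn, BE.lmul_of rfl rfl, sgn_tmul, TensorProduct.neg_tmul, smul_neg,
    Int.negOnePow_add, Int.negOnePow_even 2 even_two, one_mul]

theorem sgn_id : sgn (id 𝔥 F) = id 𝔥 F := by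
  rw [id, BE.id, sgn_tmul]
  simp

theorem sgn_of_mem {i j : ℤ} {f : LM 𝔥 F G} (hf : f ∈ bideg 𝔥 F G i j) :
    sgn f = (i.negOnePow : ℤ) • f := by
  induction hf using Submodule.span_induction with
  | mem z hz =>
    obtain ⟨n, r, a, b, f, hr, rfl, rfl, rfl⟩ := hz
    have h : lamSgn k V r = ((n : ℤ).negOnePow : ℤ) • r := by
      clear f
      induction n generalizing r with
      | zero =>
        rw [ExteriorAlgebra.exteriorPower, pow_zero, Submodule.mem_one] at hr
        obtain ⟨c, rfl⟩ := hr
        rw [AlgEquiv.commutes]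
        simp
      | succ n ih =>
        rw [ExteriorAlgebra.exteriorPower, pow_succ] at hr
        induction hr using Submodule.mul_induction_on' with
        | mem_mul_mem s hs t ht =>
          obtain ⟨m, rfl⟩ := ht
          have e' : lamSgn k V (ExteriorAlgebra.ι k m) = -ExteriorAlgebra.ι k m :=
            CliffordAlgebra.involute_ι m
          rw [map_mul, e', ih s hs, Nat.cast_succ, Int.negOnePow_succ]
          simp [mul_assoc]
        | add s _ t _ hs ht => rw [map_add, hs, ht, smul_add]
    rw [sgn_tmul, h, Int.negOnePow_add, mul_comm, Units.val_mul, ← smul_smul]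
    rfl
  | zero => simp
  | add x y _ _ hx hy => rw [map_add, hx, hy, smul_add]
  | smul c x _ hx => rw [map_smul, hx, smul_comm]

end LM

/-! ## The left-monodromic category -/

/-- A left-monodromic complex, i.e. an object of `LM(𝔥, W)`. -/
structure LMObj (𝔥 : Realization cs k V) where
  seq : DSeq B
  δ : LM 𝔥 seq seq
  δ_mem : δ ∈ LM.bideg 𝔥 seq seq 1 0
  eq : LM.comp δ δ + LM.kappa δ = 0

section Cohomology

variable {𝔥 : Realization cs k V}

/-- The differential of `uHom_LM(F, G)`:
`d(f) = κ(f) + δ_G ∘ f + (-1)^{|f| + 1} f ∘ δ_F`. -/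
def differential (F G : LMObj 𝔥) : LM 𝔥 F.seq G.seq →ₗ[k] LM 𝔥 F.seq G.seq :=
  LM.kappa + LM.comp G.δ - (LM.comp.flip F.δ) ∘ₗ LM.sgn

variable {F G H K : LMObj 𝔥}

theorem differential_apply (f : LM 𝔥 F.seq G.seq) :
    differential F G f = LM.kappa f + LM.comp G.δ f - LM.comp (LM.sgn f) F.δ := rfl

theorem differential_comp (g : LM 𝔥 G.seq H.seq) (f : LM 𝔥 F.seq G.seq) :
    differential F H (LM.comp g f) =
      LM.comp (differential G H g) f + LM.comp (LM.sgn g) (differential F G f) := by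
  simp only [differential_apply, LM.kappa_comp, LM.sgn_comp, map_add, map_sub, LinearMap.add_apply,
    LinearMap.sub_apply, LM.comp_assoc]
  abel

theorem differential_sgn (f : LM 𝔥 F.seq G.seq) :
    differential F G (LM.sgn f) = -LM.sgn (differential F G f) := by
  have hF := LM.sgn_of_mem F.δ_mem
  have hG := LM.sgn_of_mem G.δ_mem
  rw [Int.negOnePow_one, Units.val_neg, Units.val_one, neg_smul, one_smul] at hF hG
  simp only [differential_apply, LM.kappa_sgn, LM.sgn_comp, map_add, map_sub, LM.sgn_sgn, hF, hG,
    map_neg, LinearMap.neg_apply]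
  abel

theorem differential_id : differential F F (LM.id 𝔥 F.seq) = 0 := by
  rw [differential_apply, LM.sgn_id, LM.id_comp, LM.comp_id, LM.id, LM.kappa_one_tmul, zero_add,
    sub_self]

variable (F G) in
/-- The cocycles of `uHom_LM(F, G)`. -/
abbrev cocycles : Submodule k (LM 𝔥 F.seq G.seq) := LinearMap.ker (differential F G)

variable (F G) in
/-- The coboundaries of `uHom_LM(F, G)`, as a submodule of the module of cocycles. -/
abbrev coboundaries : Submodule k (cocycles F G) :=
  (LinearMap.range (differential F G)).submoduleOf (cocycles F G)

/-- The (total) cohomology `gHom_LM(F, G)` of `uHom_LM(F, G)`: cocycles modulo coboundaries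
(every coboundary is a cocycle, since `d ∘ d = 0`). -/
def gHom (F G : LMObj 𝔥) : Type _ := cocycles F G ⧸ coboundaries F G

instance : AddCommGroup (gHom F G) :=
  inferInstanceAs (AddCommGroup (cocycles F G ⧸ coboundaries F G))

instance : Module k (gHom F G) := inferInstanceAs (Module k (cocycles F G ⧸ coboundaries F G))

namespace gHom

/-- The cohomology class of a cocycle, as a linear map. -/
def cls : cocycles F G →ₗ[k] gHom F G := (coboundaries F G).mkQ

/-- The cohomology class of a cocycle. -/
def mk (f : LM 𝔥 F.seq G.seq) (hf : differential F G f = 0) : gHom F G := cls ⟨f, hf⟩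

theorem ind {P : gHom F G → Prop} (h : ∀ f hf, P (mk f hf)) (f : gHom F G) : P f := by
  obtain ⟨⟨f, hf⟩, rfl⟩ := Submodule.mkQ_surjective (coboundaries F G) f
  exact h f hf

/-- Two cocycles are cohomologous if and only if their difference is a coboundary. -/
theorem mk_eq_mk (f f' : LM 𝔥 F.seq G.seq) (hf : differential F G f = 0)
    (hf' : differential F G f' = 0) :
    mk f hf = mk f' hf' ↔ ∃ h, differential F G h = f - f' :=
  Submodule.Quotient.eq (coboundaries F G)

/-- The part of bidegree `(i, j)` of `gHom_LM(F, G)`: the classes of the cocycles of bidegree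
`(i, j)`. -/
def bideg (F G : LMObj 𝔥) (i j : ℤ) : Submodule k (gHom F G) :=
  ((LM.bideg 𝔥 F.seq G.seq i j).submoduleOf (cocycles F G)).map cls

theorem differential_comp_eq_zero {g : LM 𝔥 G.seq H.seq} {f : LM 𝔥 F.seq G.seq}
    (hg : differential G H g = 0) (hf : differential F G f = 0) :
    differential F H (LM.comp g f) = 0 := by
  rw [differential_comp, hg, hf, map_zero, LinearMap.zero_apply, map_zero, add_zero]

/-- The composition of cocycles, with values in cohomology. -/
def preComp : cocycles G H →ₗ[k] cocycles F G →ₗ[k] gHom F H :=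
  LinearMap.mk₂ k (fun g f => mk (LM.comp g.1 f.1) (differential_comp_eq_zero g.2 f.2))
    (fun g g' f => by
      refine Eq.trans (congrArg cls (Subtype.ext ?_)) (map_add cls _ _)
      exact LinearMap.map_add₂ LM.comp g.1 g'.1 f.1)
    (fun c g f => by
      refine Eq.trans (congrArg cls (Subtype.ext ?_)) (map_smul cls c _)
      exact LinearMap.map_smul₂ LM.comp c g.1 f.1)
    (fun g f f' => by
      refine Eq.trans (congrArg cls (Subtype.ext ?_)) (map_add cls _ _)
      exact map_add (LM.comp g.1) f.1 f'.1)
    (fun c g f => by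
      refine Eq.trans (congrArg cls (Subtype.ext ?_)) (map_smul cls c _)
      exact map_smul (LM.comp g.1) c f.1)

theorem preComp_apply (g : cocycles G H) (f : cocycles F G) :
    preComp g f = mk (LM.comp g.1 f.1) (differential_comp_eq_zero g.2 f.2) := rfl

theorem mk_eq_zero {f : LM 𝔥 F.seq G.seq} {hf : differential F G f = 0}
    (h : ∃ h, differential F G h = f) : mk f hf = 0 :=
  (Submodule.Quotient.mk_eq_zero (coboundaries F G)).2 h

/-- The composition `gHom_LM(G, H) ⊗ gHom_LM(F, G) → gHom_LM(F, H)`. -/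
def comp : gHom G H →ₗ[k] gHom F G →ₗ[k] gHom F H :=
  (coboundaries G H).liftQ
    (LinearMap.flip <| (coboundaries F G).liftQ preComp.flip (by
      rintro ⟨f, hf⟩ ⟨f', hf'⟩
      ext g
      refine mk_eq_zero ⟨LM.comp (LM.sgn g.1) f', ?_⟩
      rw [differential_comp, differential_sgn, LinearMap.mem_ker.1 g.2, map_zero, neg_zero,
        map_zero, LinearMap.zero_apply, zero_add, LM.sgn_sgn, hf']
      rfl))
    (by
      rintro ⟨g, hg⟩ ⟨g', hg'⟩
      refine LinearMap.mem_ker.2 (LinearMap.ext fun f => ?_)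
      induction f using ind with | _ f hf
      refine mk_eq_zero ⟨LM.comp g' f, ?_⟩
      rw [differential_comp, hf, map_zero, add_zero, hg']
      rfl)

theorem comp_mk (g : LM 𝔥 G.seq H.seq) (f : LM 𝔥 F.seq G.seq) (hg : differential G H g = 0)
    (hf : differential F G f = 0) :
    comp (mk g hg) (mk f hf) = mk (LM.comp g f) (differential_comp_eq_zero hg hf) := rfl

/-- The identity of `F`. -/
def id (F : LMObj 𝔥) : gHom F F := mk (LM.id 𝔥 F.seq) differential_id

theorem comp_assoc (h : gHom H K) (g : gHom G H) (f : gHom F G) :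
    comp (comp h g) f = comp h (comp g f) := by
  induction h using ind with | _ h hh
  induction g using ind with | _ g hg
  induction f using ind with | _ f hf
  exact congrArg cls (Subtype.ext (LM.comp_assoc h g f))

theorem id_comp (f : gHom F G) : comp (id G) f = f := by
  induction f using ind with | _ f hf
  exact congrArg cls (Subtype.ext (LM.id_comp f))

theorem comp_id (f : gHom F G) : comp f (id F) = f := by
  induction f using ind with | _ f hf
  exact congrArg cls (Subtype.ext (LM.comp_id f))

end gHom

/-- The algebra `gEnd_LM(F)`; its multiplication is the composition. -/
abbrev gEnd (F : LMObj 𝔥) : Type _ := gHom F F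

instance : Ring (gEnd F) :=
  { (inferInstance : AddCommGroup (gHom F F)) with
    mul := fun g f => gHom.comp g f
    one := gHom.id F
    mul_assoc := gHom.comp_assoc
    one_mul := gHom.id_comp
    mul_one := gHom.comp_id
    left_distrib := fun g f f' => map_add (gHom.comp g) f f'
    right_distrib := fun g g' f => LinearMap.map_add₂ gHom.comp g g' f
    zero_mul := fun f => LinearMap.map_zero₂ gHom.comp f
    mul_zero := fun g => map_zero (gHom.comp g) }

instance : Algebra k (gEnd F) :=
  Algebra.ofModule (fun c g f => LinearMap.map_smul₂ gHom.comp c g f)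
    (fun c g f => map_smul (gHom.comp g) c f)

theorem gEnd_mul (g f : gEnd F) : g * f = gHom.comp g f := rfl

end Cohomology

end Category

end LeftMonodromy

end

/-!
The contraction `x ⌢ -` is an odd derivation for the composition, and it anticommutes with `κ`.
Hence, for every `f` in `uHom_LM(F, G)`,
`d (x ⌢ f) = (x ⌢ δ_G) ∘ f - f ∘ (x ⌢ δ_F) - x ⌢ d f`.
For `f = δ_F`, where `d δ_F = δ_F ∘ δ_F`, this says that `x ⌢ δ_F` is a cocycle. For a cocycle `f`,
it exhibits `x ⌢ f` as a homotopy between `(x ⌢ δ_G) ∘ f` and `f ∘ (x ⌢ δ_F)`, so that the family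
of the classes `[x ⌢ δ_F]` lies in the center of the cohomology category. The center is a
commutative algebra, so the universal property of `Sym(V)` extends this family to a homomorphism
from `R^∨` to the center.
-/

noncomputable section

namespace LeftMonodromy

section Algebra

variable {R M : Type*} [CommRing R] [AddCommGroup M] [Module R M]

theorem symmetricAlgebra_algHom_ext {A : Type*} [Semiring A] [Algebra R A]
    {f g : SymmetricAlgebra R M →ₐ[R] A}
    (h : ∀ x, f (SymmetricAlgebra.ι R M x) = g (SymmetricAlgebra.ι R M x)) : f = g :=
  (AlgHom.cancel_right (SymmetricAlgebra.algHom_surjective R M)).1 <|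
    TensorAlgebra.hom_ext <| LinearMap.ext h

section Clifford

open CliffordAlgebra

variable {Q : QuadraticForm R M}

theorem contractLeft_eq_zero_of_mem_ι_range_pow_zero (d : Module.Dual R M) {x : CliffordAlgebra Q}
    (hx : x ∈ LinearMap.range (ι Q) ^ 0) : contractLeft d x = 0 := by
  rw [pow_zero] at hx
  obtain ⟨c, rfl⟩ := Submodule.mem_one.1 hx
  exact contractLeft_algebraMap Q d c

theorem contractLeft_mem_ι_range_pow (d : Module.Dual R M) {n : ℕ} {x : CliffordAlgebra Q}
    (hx : x ∈ LinearMap.range (ι Q) ^ (n + 1)) :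
    contractLeft d x ∈ LinearMap.range (ι Q) ^ n := by
  suffices h : LinearMap.range (ι Q) ^ (n + 1) ≤
      (LinearMap.range (ι Q) ^ n).comap (contractLeft d) from h hx
  rw [pow_succ', Submodule.mul_le]
  rintro _ ⟨m, rfl⟩ y hy
  rw [Submodule.mem_comap, contractLeft_ι_mul]
  refine Submodule.sub_mem _ (Submodule.smul_mem _ _ hy) ?_
  cases n with
  | zero =>
    rw [contractLeft_eq_zero_of_mem_ι_range_pow_zero d hy, mul_zero]
    exact Submodule.zero_mem _
  | succ n =>
    rw [pow_succ']
    exact Submodule.mul_mem_mul ⟨m, rfl⟩ (contractLeft_mem_ι_range_pow d hy)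

theorem ι_range_pow_map_involute (Q : QuadraticForm R M) (n : ℕ) :
    (LinearMap.range (ι Q) ^ n).map (involute (Q := Q)).toLinearMap =
      LinearMap.range (ι Q) ^ n := by
  rw [Submodule.map_pow, ι_range_map_involute]

open scoped Pointwise in
theorem involuteEquiv_zpow_mem_ι_range_pow (i : ℤ) {n : ℕ} {x : CliffordAlgebra Q}
    (hx : x ∈ LinearMap.range (ι Q) ^ n) :
    (involuteEquiv ^ i : CliffordAlgebra Q ≃ₐ[R] CliffordAlgebra Q) x ∈
      LinearMap.range (ι Q) ^ n := by
  have hi : (involuteEquiv ^ i : CliffordAlgebra Q ≃ₐ[R] CliffordAlgebra Q) ∈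
      MulAction.stabilizer _ (LinearMap.range (ι Q) ^ n) :=
    zpow_mem (MulAction.mem_stabilizer_iff.2 (ι_range_pow_map_involute Q n)) i
  rw [← MulAction.mem_stabilizer_iff.1 hi]
  exact Submodule.smul_mem_pointwise_smul _ _ _ hx

end Clifford

theorem pow_le_graded {ι A : Type*} [AddMonoid ι] [Semiring A] [Algebra R A]
    (𝒜 : ι → Submodule R A) [SetLike.GradedMonoid 𝒜] {i : ι} {P : Submodule R A} (hP : P ≤ 𝒜 i)
    (n : ℕ) : P ^ n ≤ 𝒜 (n • i) := by
  induction n with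
  | zero => simpa only [pow_zero, zero_smul] using Submodule.one_le.2 (SetLike.GradedOne.one_mem)
  | succ n ih =>
    rw [pow_succ, succ_nsmul, Submodule.mul_le]
    exact fun a ha b hb => SetLike.mul_mem_graded (ih ha) (hP hb)

end Algebra

variable {B W : Type*} [Group W] {M : CoxeterMatrix B} {cs : CoxeterSystem M W}
variable {k V : Type*} [CommRing k] [AddCommGroup V] [Module k V]

theorem contract_add (x y : V) :
    (contract (x + y) : Lam k V →ₗ[k] Lam k V) = contract x + contract y := by
  simp only [contract, map_add]

theorem contract_smul (c : k) (x : V) :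
    (contract (c • x) : Lam k V →ₗ[k] Lam k V) = c • contract x := by
  simp only [contract, map_smul]

variable [IsDomain k] [Module.Free k V] [Module.Finite k V]

namespace LM

variable {𝔥 : Realization cs k V} {F G H : DSeq B}

theorem frown_tmul (x : V) (r : Lam k V) (f : BE 𝔥 F G) :
    frown x (r ⊗ₜ[k] f) = contract x r ⊗ₜ[k] f := rfl

theorem frown_add_left (x y : V) (f : LM 𝔥 F G) : frown (x + y) f = frown x f + frown y f := by
  rw [frown, contract_add, TensorProduct.map_add_left]
  rfl

theorem frown_smul_left (c : k) (x : V) (f : LM 𝔥 F G) : frown (c • x) f = c • frown x f := by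
  rw [frown, contract_smul, TensorProduct.map_smul_left]
  rfl

theorem frown_comp (x : V) (g : LM 𝔥 G H) (f : LM 𝔥 F G) :
    frown x (comp g f) = comp (frown x g) f + comp (sgn g) (frown x f) := by
  induction g using induction with
  | zero => simp
  | add g g' ih ih' => simp only [map_add, LinearMap.add_apply, ih, ih']; abel
  | tmul r i' j' g =>
  induction f using induction with
  | zero => simp
  | add f f' ih ih' => simp only [map_add, ih, ih']; abel
  | tmul s i j f =>
  rw [sgn_tmul, map_zsmul, LinearMap.smul_apply, frown_tmul, frown_tmul, comp_tmul, comp_tmul,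
    comp_tmul, frown_tmul, contract_mul, contract_lamSgn_zpow, TensorProduct.add_tmul,
    mul_smul_comm]
  rfl

theorem frown_kappa (x : V) (f : LM 𝔥 F G) : frown x (kappa f) = -kappa (frown x f) := by
  suffices h : frown x ∘ₗ kappa (𝔥 := 𝔥) (F := F) (G := G) = -(kappa ∘ₗ frown x) from
    LinearMap.congr_fun h f
  refine TensorProduct.ext' fun r f => ?_
  simp only [LinearMap.comp_apply, LinearMap.neg_apply, frown_tmul, kappa_tmul, map_sum,
    ← Finset.sum_neg_distrib, ← TensorProduct.neg_tmul]
  refine Finset.sum_congr rfl fun a _ => congrArg (· ⊗ₜ[k] _) ?_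
  exact CliffordAlgebra.contractLeft_comm _ _ r

theorem frown_sgn (x : V) (f : LM 𝔥 F G) : frown x (sgn f) = -sgn (frown x f) := by
  suffices h : frown x ∘ₗ sgn (𝔥 := 𝔥) (F := F) (G := G) = -(sgn ∘ₗ frown x) from
    LinearMap.congr_fun h f
  refine TensorProduct.ext' fun r f => ?_
  change contract x (lamSgn k V r) ⊗ₜ[k] BE.sgn f = -(lamSgn k V (contract x r) ⊗ₜ[k] BE.sgn f)
  rw [contract_lamSgn, TensorProduct.neg_tmul]

theorem frown_mem_bideg (x : V) {i j : ℤ} {f : LM 𝔥 F G} (hf : f ∈ bideg 𝔥 F G i j) :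
    frown x f ∈ bideg 𝔥 F G (i - 1) (j - 2) := by
  suffices h : bideg 𝔥 F G i j ≤ (bideg 𝔥 F G (i - 1) (j - 2)).comap (frown x) from h hf
  refine Submodule.span_le.2 ?_
  rintro _ ⟨n, r, a, b, f, hr, rfl, rfl, rfl⟩
  rw [SetLike.mem_coe, Submodule.mem_comap, frown_tmul]
  cases n with
  | zero =>
    rw [contract, contractLeft_eq_zero_of_mem_ι_range_pow_zero _ hr, TensorProduct.zero_tmul]
    exact Submodule.zero_mem _
  | succ n =>
    exact Submodule.subset_span ⟨n, _, a, b, f, contractLeft_mem_ι_range_pow _ hr,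
      by push_cast; ring, by push_cast; ring, rfl⟩

theorem comp_mem_bideg {i j i' j' : ℤ} {g : LM 𝔥 G H} {f : LM 𝔥 F G}
    (hg : g ∈ bideg 𝔥 G H i' j') (hf : f ∈ bideg 𝔥 F G i j) :
    comp g f ∈ bideg 𝔥 F H (i' + i) (j' + j) := by
  refine LinearMap.BilinMap.apply_apply_mem_of_mem_span _ _ _ comp ?_ g f hg hf
  rintro _ ⟨p, r, a, b, g, hr, rfl, rfl, rfl⟩ _ ⟨q, s, a', b', f, hs, rfl, rfl, rfl⟩
  rw [comp_tmul, BE.comp_of rfl rfl]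
  refine Submodule.subset_span ⟨p + q, _, _, _, _, ?_, by push_cast; ring, by push_cast; ring, rfl⟩
  rw [ExteriorAlgebra.exteriorPower, pow_add]
  exact Submodule.mul_mem_mul hr (involuteEquiv_zpow_mem_ι_range_pow a hs)

theorem id_mem_bideg : id 𝔥 F ∈ bideg 𝔥 F F 0 0 := by
  refine Submodule.subset_span ⟨0, 1, 0, 0, _, ?_, rfl, rfl, rfl⟩
  rw [ExteriorAlgebra.exteriorPower, pow_zero]
  exact Submodule.one_le.1 le_rfl

end LM

variable {𝔥 : Realization cs k V} {F G H : LMObj 𝔥}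

theorem sgn_δ (F : LMObj 𝔥) : LM.sgn F.δ = -F.δ := by
  simpa using LM.sgn_of_mem F.δ_mem

theorem differential_δ (F : LMObj 𝔥) : differential F F F.δ = LM.comp F.δ F.δ := by
  rw [differential_apply, sgn_δ, map_neg, LinearMap.neg_apply, sub_neg_eq_add,
    add_comm (LM.kappa _), F.eq, zero_add]

theorem differential_frown (x : V) (f : LM 𝔥 F.seq G.seq) :
    differential F G (LM.frown x f) = LM.comp (LM.frown x G.δ) f - LM.comp f (LM.frown x F.δ) -
      LM.frown x (differential F G f) := by
  simp only [differential_apply, map_add, map_sub, LM.frown_comp, LM.frown_kappa, LM.frown_sgn,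
    LM.sgn_sgn, sgn_δ, map_neg, LinearMap.neg_apply]
  abel

theorem differential_frown_δ (F : LMObj 𝔥) (x : V) : differential F F (LM.frown x F.δ) = 0 := by
  rw [differential_frown, differential_δ, LM.frown_comp, sgn_δ, map_neg, LinearMap.neg_apply]
  abel

namespace gHom

theorem mk_mem_bideg {f : LM 𝔥 F.seq G.seq} (hf : differential F G f = 0) {i j : ℤ}
    (h : f ∈ LM.bideg 𝔥 F.seq G.seq i j) : mk f hf ∈ bideg F G i j :=
  ⟨⟨f, hf⟩, h, rfl⟩

theorem comp_mem_bideg {i j i' j' : ℤ} {g : gHom G H} {f : gHom F G} (hg : g ∈ bideg G H i' j')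
    (hf : f ∈ bideg F G i j) : comp g f ∈ bideg F H (i' + i) (j' + j) := by
  obtain ⟨⟨g, hg₀⟩, hg, rfl⟩ := hg
  obtain ⟨⟨f, hf₀⟩, hf, rfl⟩ := hf
  exact mk_mem_bideg (differential_comp_eq_zero hg₀ hf₀) (LM.comp_mem_bideg hg hf)

instance (F : LMObj 𝔥) :
    SetLike.GradedMonoid fun ij : ℤ × ℤ => (bideg F F ij.1 ij.2 : Submodule k (gEnd F)) where
  one_mem := mk_mem_bideg differential_id LM.id_mem_bideg
  mul_mem _ _ _ _ hg hf := comp_mem_bideg hg hf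

/-- The center of the cohomology category, i.e. the algebra of natural endomorphisms of its identity
functor, encoded as a subalgebra of the product of all endomorphism algebras. -/
def center (𝔥 : Realization cs k V) : Subalgebra k (∀ F : LMObj 𝔥, gEnd F) where
  carrier := {z | ∀ (F G : LMObj 𝔥) (f : gHom F G), comp (z G) f = comp f (z F)}
  mul_mem' {z z'} hz hz' F G f := by
    simp only [Pi.mul_apply, gEnd_mul]
    rw [comp_assoc, hz', ← comp_assoc, hz, comp_assoc]
  add_mem' {z z'} hz hz' F G f := by
    simp only [Pi.add_apply, map_add, LinearMap.add_apply]
    rw [hz, hz']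
  algebraMap_mem' c F G f := by
    simp only [Pi.algebraMap_apply, Algebra.algebraMap_eq_smul_one, map_smul, LinearMap.smul_apply]
    exact congrArg (c • ·) ((id_comp f).trans (comp_id f).symm)

instance : CommRing (center 𝔥) where
  mul_comm z z' := Subtype.ext <| funext fun F => z.2 F F (z'.1 F)

/-- The monodromy operators of `F`: the classes `[x ⌢ δ_F]` for `x ∈ V`. -/
def monodromy (F : LMObj 𝔥) : V →ₗ[k] gEnd F :=
  cls ∘ₗ
    { toFun x := ⟨LM.frown x F.δ, differential_frown_δ F x⟩
      map_add' x y := Subtype.ext (LM.frown_add_left x y F.δ)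
      map_smul' c x := Subtype.ext (LM.frown_smul_left c x F.δ) }

theorem monodromy_apply (F : LMObj 𝔥) (x : V) :
    monodromy F x = mk (LM.frown x F.δ) (differential_frown_δ F x) := rfl

theorem monodromy_mem_bideg (F : LMObj 𝔥) (x : V) : monodromy F x ∈ bideg F F 0 (-2) :=
  mk_mem_bideg (i := 0) (j := -2) _ <| by simpa using LM.frown_mem_bideg x F.δ_mem

theorem monodromy_comp (x : V) (f : gHom F G) :
    comp (monodromy G x) f = comp f (monodromy F x) := by
  induction f using ind with | _ f hf
  rw [monodromy_apply, monodromy_apply, comp_mk, comp_mk, mk_eq_mk]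
  exact ⟨LM.frown x f, by rw [differential_frown, hf, map_zero, sub_zero]⟩

/-- The monodromy action of `R^∨ = Sym(V)` on the whole cohomology category: the algebra
homomorphism to the center that extends `x ↦ ([x ⌢ δ_F])_F`. -/
def centralMonodromy (𝔥 : Realization cs k V) : SymmetricAlgebra k V →ₐ[k] center 𝔥 :=
  SymmetricAlgebra.lift <| (LinearMap.pi monodromy).codRestrict (Subalgebra.toSubmodule (center 𝔥))
    fun x _ _ => monodromy_comp x

/-- The homomorphism `μ_F : R^∨ → gEnd_LM(F)`, obtained as the component at `F` of
`centralMonodromy`. -/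
def monodromyHom (F : LMObj 𝔥) : SymmetricAlgebra k V →ₐ[k] gEnd F :=
  (Pi.evalAlgHom k (fun F : LMObj 𝔥 => gEnd F) F).comp ((center 𝔥).val.comp (centralMonodromy 𝔥))

theorem monodromyHom_ι (F : LMObj 𝔥) (x : V) :
    monodromyHom F (SymmetricAlgebra.ι k V x) = monodromy F x :=
  congrArg (fun z : center 𝔥 => z.1 F) (SymmetricAlgebra.lift_ι_apply _ x)

theorem monodromyHom_comp (y : SymmetricAlgebra k V) (f : gHom F G) :
    comp (monodromyHom G y) f = comp f (monodromyHom F y) :=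
  (centralMonodromy 𝔥 y).2 F G f

theorem monodromyHom_mem_bideg (F : LMObj 𝔥) {n : ℕ} {y : SymmetricAlgebra k V}
    (hy : y ∈ symDeg k V n) : monodromyHom F y ∈ bideg F F 0 (-2 * n) := by
  have hι : (LinearMap.range (SymmetricAlgebra.ι k V)).map (monodromyHom F).toLinearMap ≤
      bideg F F 0 (-2) := by
    rintro _ ⟨_, ⟨x, rfl⟩, rfl⟩
    exact (monodromyHom_ι F x).symm ▸ monodromy_mem_bideg F x
  have h := pow_le_graded (fun ij : ℤ × ℤ => bideg F F ij.1 ij.2) (i := (0, -2)) hι n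
  rw [← Submodule.map_pow] at h
  convert h ⟨y, hy, rfl⟩ using 2 <;> simp [mul_comm]

theorem eq_monodromyHom {F : LMObj 𝔥} {ν : SymmetricAlgebra k V →ₐ[k] gEnd F}
    (h : ∀ x, ν (SymmetricAlgebra.ι k V x) = monodromy F x) : ν = monodromyHom F :=
  symmetricAlgebra_algHom_ext fun x => (h x).trans (monodromyHom_ι F x).symm

/-- The left action of `gEnd_LM(G)` on `gHom_LM(F, G)` by composition. -/
def postcomp (F G : LMObj 𝔥) : gEnd G →ₐ[k] Module.End k (gHom F G) :=
  AlgHom.ofLinearMap comp (LinearMap.ext id_comp) fun g g' => LinearMap.ext (comp_assoc g g')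

/-- The action of `R^∨` on `gHom_LM(F, G)`, encoded as the homomorphism that sends `y` to the
endomorphism by which `y` acts. -/
def leftAction (F G : LMObj 𝔥) : SymmetricAlgebra k V →ₐ[k] Module.End k (gHom F G) :=
  (postcomp F G).comp (monodromyHom G)

theorem leftAction_apply (y : SymmetricAlgebra k V) (f : gHom F G) :
    leftAction F G y f = comp (monodromyHom G y) f := rfl

theorem leftAction_eq_comp_monodromyHom (y : SymmetricAlgebra k V) (f : gHom F G) :
    leftAction F G y f = comp f (monodromyHom F y) :=
  monodromyHom_comp y f

theorem leftAction_mem_bideg {n : ℕ} {y : SymmetricAlgebra k V} (hy : y ∈ symDeg k V n) {i j : ℤ}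
    {f : gHom F G} (hf : f ∈ bideg F G i j) : leftAction F G y f ∈ bideg F G i (j - 2 * n) := by
  have h := comp_mem_bideg (monodromyHom_mem_bideg G hy) hf
  rwa [zero_add, neg_mul, neg_add_eq_sub] at h

theorem leftAction_comp_left (y : SymmetricAlgebra k V) (g : gHom G H) (f : gHom F G) :
    leftAction F H y (comp g f) = comp (leftAction G H y g) f :=
  (comp_assoc _ g f).symm

theorem leftAction_comp_right (y : SymmetricAlgebra k V) (g : gHom G H) (f : gHom F G) :
    leftAction F H y (comp g f) = comp g (leftAction F G y f) := by
  rw [leftAction_eq_comp_monodromyHom, leftAction_eq_comp_monodromyHom, comp_assoc]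

end gHom

end LeftMonodromy

end

theorem mainTheorem3_general {B W : Type*} [Group W] {M : CoxeterMatrix B}
    {cs : CoxeterSystem M W} {k V : Type*} [CommRing k] [IsDomain k] [AddCommGroup V] [Module k V]
    [Module.Free k V] [Module.Finite k V] (𝔥 : LeftMonodromy.Realization cs k V) :
    ∃ (μ : ∀ F : LeftMonodromy.LMObj 𝔥, SymmetricAlgebra k V →ₐ[k] LeftMonodromy.gEnd F)
      (star : ∀ F G : LeftMonodromy.LMObj 𝔥,
        SymmetricAlgebra k V →ₐ[k] Module.End k (LeftMonodromy.gHom F G)),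
      (∀ F : LeftMonodromy.LMObj 𝔥,
        (∀ x : V, ∃ hx : LeftMonodromy.differential F F (LeftMonodromy.LM.frown x F.δ) = 0,
          μ F (SymmetricAlgebra.ι k V x) =
            LeftMonodromy.gHom.mk (LeftMonodromy.LM.frown x F.δ) hx) ∧
        (∀ ν : SymmetricAlgebra k V →ₐ[k] LeftMonodromy.gEnd F,
          (∀ x : V, ∃ hx : LeftMonodromy.differential F F (LeftMonodromy.LM.frown x F.δ) = 0,
            ν (SymmetricAlgebra.ι k V x) =
              LeftMonodromy.gHom.mk (LeftMonodromy.LM.frown x F.δ) hx) → ν = μ F) ∧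
        (∀ n : ℕ, ∀ y ∈ LeftMonodromy.symDeg k V n,
          μ F y ∈ LeftMonodromy.gHom.bideg F F 0 (-2 * n))) ∧
      (∀ (F G : LeftMonodromy.LMObj 𝔥),
        (∀ (y : SymmetricAlgebra k V) (f : LeftMonodromy.gHom F G),
          star F G y f = LeftMonodromy.gHom.comp (μ G y) f ∧
          star F G y f = LeftMonodromy.gHom.comp f (μ F y)) ∧
        (∀ n : ℕ, ∀ y ∈ LeftMonodromy.symDeg k V n, ∀ i j : ℤ,
          ∀ f ∈ LeftMonodromy.gHom.bideg F G i j,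
            star F G y f ∈ LeftMonodromy.gHom.bideg F G i (j - 2 * n))) ∧
      (∀ (F G H : LeftMonodromy.LMObj 𝔥) (y : SymmetricAlgebra k V)
        (g : LeftMonodromy.gHom G H) (f : LeftMonodromy.gHom F G),
        star F H y (LeftMonodromy.gHom.comp g f) =
            LeftMonodromy.gHom.comp (star G H y g) f ∧
        star F H y (LeftMonodromy.gHom.comp g f) =
            LeftMonodromy.gHom.comp g (star F G y f)) := by
  open LeftMonodromy gHom in
  refine ⟨monodromyHom, leftAction, fun F => ⟨fun x => ?_, fun ν hν => ?_, fun n y hy => ?_⟩,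
    fun F G => ⟨fun y f => ?_, fun n y hy i j f hf => ?_⟩, fun F G H y g f => ?_⟩
  · exact ⟨differential_frown_δ F x, monodromyHom_ι F x⟩
  · exact eq_monodromyHom fun x => (hν x).choose_spec
  · exact monodromyHom_mem_bideg F hy
  · exact ⟨leftAction_apply y f, leftAction_eq_comp_monodromyHom y f⟩
  · exact leftAction_mem_bideg hy hf
  · exact ⟨leftAction_comp_left y g f, leftAction_comp_right y g f⟩

theorem mainTheorem3 {B W : Type*} [Finite B] [Group W] {M : CoxeterMatrix B}
    {cs : CoxeterSystem M W} {k V : Type*} [CommRing k] [IsDomain k] [AddCommGroup V] [Module k V]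
    [Module.Free k V] [Module.Finite k V] (𝔥 : LeftMonodromy.Realization cs k V) :
    ∃ (μ : ∀ F : LeftMonodromy.LMObj 𝔥, SymmetricAlgebra k V →ₐ[k] LeftMonodromy.gEnd F)
      (star : ∀ F G : LeftMonodromy.LMObj 𝔥,
        SymmetricAlgebra k V →ₐ[k] Module.End k (LeftMonodromy.gHom F G)),
      (∀ F : LeftMonodromy.LMObj 𝔥,
        -- `μ_F` is determined by `μ_F(x) = x ⌢ δ_F`, which is a cocycle
        (∀ x : V, ∃ hx : LeftMonodromy.differential F F (LeftMonodromy.LM.frown x F.δ) = 0,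
          μ F (SymmetricAlgebra.ι k V x) =
            LeftMonodromy.gHom.mk (LeftMonodromy.LM.frown x F.δ) hx) ∧
        (∀ ν : SymmetricAlgebra k V →ₐ[k] LeftMonodromy.gEnd F,
          (∀ x : V, ∃ hx : LeftMonodromy.differential F F (LeftMonodromy.LM.frown x F.δ) = 0,
            ν (SymmetricAlgebra.ι k V x) =
              LeftMonodromy.gHom.mk (LeftMonodromy.LM.frown x F.δ) hx) → ν = μ F) ∧
        -- `μ_F` is bigraded
        (∀ n : ℕ, ∀ y ∈ LeftMonodromy.symDeg k V n,
          μ F y ∈ LeftMonodromy.gHom.bideg F F 0 (-2 * n))) ∧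
      (∀ (F G : LeftMonodromy.LMObj 𝔥),
        -- the action is given by composition with `μ` on either side, and is bigraded
        (∀ (y : SymmetricAlgebra k V) (f : LeftMonodromy.gHom F G),
          star F G y f = LeftMonodromy.gHom.comp (μ G y) f ∧
          star F G y f = LeftMonodromy.gHom.comp f (μ F y)) ∧
        (∀ n : ℕ, ∀ y ∈ LeftMonodromy.symDeg k V n, ∀ i j : ℤ,
          ∀ f ∈ LeftMonodromy.gHom.bideg F G i j,
            star F G y f ∈ LeftMonodromy.gHom.bideg F G i (j - 2 * n))) ∧
      -- the action is compatible with composition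
      (∀ (F G H : LeftMonodromy.LMObj 𝔥) (y : SymmetricAlgebra k V)
        (g : LeftMonodromy.gHom G H) (f : LeftMonodromy.gHom F G),
        star F H y (LeftMonodromy.gHom.comp g f) =
            LeftMonodromy.gHom.comp (star G H y g) f ∧
        star F H y (LeftMonodromy.gHom.comp g f) =
            LeftMonodromy.gHom.comp g (star F G y f)) :=
  mainTheorem3_general 𝔥
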